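/- Let $n\in\mathbb N$, $\varepsilon>0$, $T>0$, and let $X$ be either the flat torus $\mathbb T^n=\mathbb R^n/\mathbb Z^n$ or an open set $\Omega\subset\mathbb R^n$, bounded or unbounded ($\Omega=\mathbb R^n$ is allowed). Consider the backward viscous Hamilton–Jacobi problem $$-\partial_t u-\varepsilon\Delta u+H(x,t,Du)=f(x,t)\ \text{ in } X\times(0,T),\qquad u(\cdot,T)=g\ \text{ in } X,$$ with the homogeneous Neumann condition $\partial_\nu u=0$ on $\partial\Omega\times(0,T)$ if $X=\Omega$. An *energy solution* is a function $u\in C([0,T];L^2(X))\cap L^2(0,T;H^1(X))$ with $H(\cdot,\cdot,Du)\in L^1((X\cap S)\times(0,T))$ for every bounded measurable $S$ and $u(T)=g$ a.e., such that for all $\psi\in H^1(X)\cap L^\infty(X)$ with bounded support (not required to vanish on $\partial\Omega$) and all $t\in[0,T]$ $$\int_X u(t)\psi\,dx=\int_X g\psi\,dx-\int_t^T\!\!\int_X\big(\varepsilon Du\cdot D\psi+H(x,s,Du)\psi-f\psi\big)\,dx\,ds .$$ Let $g_1,g_2\in L^\infty(X)$ and $f_1,f_2\in L^1(0,T;L^\infty(X))$,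 and let $u_1,u_2$ be energy solutions with data $(f_1,g_1)$ and $(f_2,g_2)$ and the same $H$. Assume that for a.e. $(x,t)\in X\times(0,T)$ the function $p\mapsto H(x,t,p)$ is differentiable, that $\theta\mapsto D_pH(x,t,\theta Du_1(x,t)+(1-\theta)Du_2(x,t))$ is integrable on $[0,1]$, and that the drift $$b(x,t)=\int_0^1 D_pH\big(x,t,\theta Du_1(x,t)+(1-\theta)Du_2(x,t)\big)\,d\theta$$ is essentially bounded on $X\times(0,T)$. (This holds for instance if $D_pH(x,t,p)$ is bounded uniformly in $(x,t)$ for $p$ in bounded sets and $Du_1,Du_2$ are bounded.) Then for all $t\in(0,T)$ $$\|(u_1-u_2)(t)\|_{L^\infty(X)}\le\|g_1-g_2\|_{L^\infty(X)}+\int_0^T\|f_1(s)-f_2(s)\|_{L^\infty(X)}\,ds .$$ -/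

import Mathlib

open MeasureTheory Set Filter Topology
open scoped ENNReal ContDiff

/-- Euclidean space `ℝⁿ`. -/
abbrev Euc (n : ℕ) : Type := EuclideanSpace ℝ (Fin n)

/-- `G` is the weak (distributional) gradient of `v` in the open set `Ω ⊆ ℝⁿ`. -/
def HasWeakGradientOn {n : ℕ} (Ω : Set (Euc n)) (v : Euc n → ℝ) (G : Euc n → Euc n) : Prop :=
  LocallyIntegrableOn v Ω volume ∧ LocallyIntegrableOn G Ω volume ∧
    ∀ φ : Euc n → ℝ, ContDiff ℝ ∞ φ → HasCompactSupport φ → tsupport φ ⊆ Ω →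
      ∫ x in Ω, v x • gradient φ x = -∫ x in Ω, φ x • G x

/-- The covering map `ℝⁿ → 𝕋ⁿ = ℝⁿ / ℤⁿ`. -/
def toTorus (n : ℕ) (x : Euc n) : UnitAddTorus (Fin n) := fun i => (x i : UnitAddCircle)

/-- `G` is the weak gradient of `v` on the flat torus: the periodic lift of `G` to `ℝⁿ` is the
weak gradient of the periodic lift of `v`. -/
def HasWeakGradientTorus {n : ℕ} (v : UnitAddTorus (Fin n) → ℝ)
    (G : UnitAddTorus (Fin n) → Euc n) : Prop :=
  HasWeakGradientOn univ (v ∘ toTorus n) (G ∘ toTorus n)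

/-- The measure `dt ⊗ μ` on the space-time cylinder `(a, b) × X`. -/
noncomputable def spaceTimeMeasure {X : Type*} [MeasurableSpace X] (μ : Measure X) (a b : ℝ) :
    Measure (ℝ × X) :=
  (volume.restrict (Ioo a b)).prod μ

/-- `f ∈ L¹(0, T; L^∞(X, μ))`. -/
def MemL1Linf {X : Type*} [MeasurableSpace X] (μ : Measure X) (T : ℝ) (f : ℝ → X → ℝ) : Prop :=
  AEStronglyMeasurable (fun z : ℝ × X => f z.1 z.2) (spaceTimeMeasure μ 0 T) ∧
    ∫⁻ t in Ioo 0 T, eLpNorm (f t) ∞ μ < ⊤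

/-- Admissible test functions, with their weak gradients: `ψ ∈ H¹ ∩ L^∞` with bounded support.
They are not required to vanish at the boundary. `WG ψ Dψ` means that `Dψ` is the weak
gradient of `ψ`. -/
structure IsTestFunction {n : ℕ} {X : Type*} [MeasurableSpace X] [Bornology X] (μ : Measure X)
    (WG : (X → ℝ) → (X → Euc n) → Prop) (ψ : X → ℝ) (Dψ : X → Euc n) : Prop where
  memLp_two : MemLp ψ 2 μ
  memLp_top : MemLp ψ ∞ μ
  bounded_support : Bornology.IsBounded (Function.support ψ)
  grad_memLp : MemLp Dψ 2 μ
  weak_grad : WG ψ Dψ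

/-- `u`, with weak spatial gradient `Du`, is an energy solution of the backward problem
`-∂ₜu - ε Δu + H(x, t, Du) = f` in `X × (0, T)`, `u(T) = g`:
`u ∈ C([0, T]; L²) ∩ L²(0, T; H¹)`, and the equation holds in variational form. Since test
functions need not vanish at the boundary of the domain, the variational form contains
the homogeneous Neumann condition `∂_ν u = 0`. -/
structure IsEnergySolution {n : ℕ} {X : Type*} [MeasurableSpace X] [Bornology X] (μ : Measure X)
    (WG : (X → ℝ) → (X → Euc n) → Prop) (ε T : ℝ) (H : ℝ → X → Euc n → ℝ)
    (f : ℝ → X → ℝ) (g : X → ℝ) (u : ℝ → X → ℝ) (Du : ℝ → X → Euc n) : Prop where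
  slice_memLp : ∀ t ∈ Icc 0 T, MemLp (u t) 2 μ
  continuous_in_time : ∀ t ∈ Icc 0 T,
    Tendsto (fun s => eLpNorm (u s - u t) 2 μ) (𝓝[Icc 0 T] t) (𝓝 0)
  memLp : MemLp (fun z : ℝ × X => u z.1 z.2) 2 (spaceTimeMeasure μ 0 T)
  grad_memLp : MemLp (fun z : ℝ × X => Du z.1 z.2) 2 (spaceTimeMeasure μ 0 T)
  weak_grad : ∀ᵐ t ∂(volume.restrict (Ioo 0 T)), WG (u t) (Du t)
  hamiltonian_integrable : ∀ S : Set X, MeasurableSet S → Bornology.IsBounded S →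
    IntegrableOn (fun z : ℝ × X => H z.1 z.2 (Du z.1 z.2)) (univ ×ˢ S) (spaceTimeMeasure μ 0 T)
  terminal : u T =ᵐ[μ] g
  equation : ∀ ψ Dψ, IsTestFunction μ WG ψ Dψ → ∀ t ∈ Icc 0 T,
    ∫ x, u t x * ψ x ∂μ = ∫ x, g x * ψ x ∂μ -
      ∫ z, (ε * inner ℝ (Du z.1 z.2) (Dψ z.2) + H z.1 z.2 (Du z.1 z.2) * ψ z.2
        - f z.1 z.2 * ψ z.2) ∂(spaceTimeMeasure μ t T)

/-- The drift `b(x, t) = ∫₀¹ D_pH(x, t, θ Du₁ + (1 - θ) Du₂) dθ` of the linearized equation,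
where `p₁ = Du₁(x, t)` and `p₂ = Du₂(x, t)`, for the function `h = H(x, t, ·)`. -/
noncomputable def linearizedDrift {n : ℕ} (h : Euc n → ℝ) (p₁ p₂ : Euc n) : Euc n :=
  ∫ θ in (0 : ℝ)..1, gradient h (θ • p₁ + (1 - θ) • p₂)

/-- Almost everywhere in `X × (0, T)` the function `H(x, t, ·)` is differentiable and the drift
of the linearized equation is well defined, and this drift is essentially bounded. -/
def HasBoundedDrift {n : ℕ} {X : Type*} [MeasurableSpace X] (μ : Measure X) (T : ℝ)
    (H : ℝ → X → Euc n → ℝ) (Du₁ Du₂ : ℝ → X → Euc n) : Prop :=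
  ∃ M : ℝ, ∀ᵐ z ∂(spaceTimeMeasure μ 0 T),
    Differentiable ℝ (H z.1 z.2) ∧
    IntervalIntegrable
      (fun θ : ℝ => gradient (H z.1 z.2) (θ • Du₁ z.1 z.2 + (1 - θ) • Du₂ z.1 z.2)) volume 0 1 ∧
    ‖linearizedDrift (H z.1 z.2) (Du₁ z.1 z.2) (Du₂ z.1 z.2)‖ ≤ M

/-! Put w = u₁ - u₂ and k(t) = ‖g₁ - g₂‖_∞ + ∫_t^T ‖f₁(s) - f₂(s)‖_∞ ds. Integrating D_pH along the
segment from Du₂ to Du₁ gives |H(Du₁) - H(Du₂)| ≤ M |Dw| (`abs_sub_le_norm_linearizedDrift_mul`). So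
the difference of the Hamiltonians lies in L² of space-time, although each of them is only locally
integrable. Against a nonnegative test function, f₁ - f₂ is dominated by the decrease of k, and k(T)
dominates the terminal difference. Hence w - k is a subsolution of a linear problem without source
(`IsEnergySubsolution`, `isEnergySubsolution_sub`). Testing with (w - k)₊ and using Young's
inequality to absorb the drift into ε|Dw|² gives ∫ (w - k)₊²(a) ≤ M²/(2ε) ∫_a^T ∫ (w - k)₊², and
Gronwall forces w ≤ k (`integral_posPart_sq_le`, `le_level`). Exchanging the two solutions bounds
|w|, and k(t) is at most the right-hand side of the claim.

Two obstacles stand in the way of this test function. The first is that (w - k)₊ need be neither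
bounded nor boundedly supported, and the positive part is not C¹. It is replaced by `softRamp d`
applied to w - k, times a spatial cutoff ζ. The chain and product rules for weak gradients make this
admissible, and dominated convergence removes d and ζ at the end. The cutoff acts only at infinity,
never near ∂Ω, which is where the Neumann condition is used.

The second is that the test function depends on time while the equation admits only stationary ones.
No time derivative of w is introduced. The test function is frozen at time s, and convexity of the
primitive of the ramp bounds the energy increment between s and s + δ by an integral pairing the
frozen factor with the equation on (s, s + δ) (`truncatedEnergy_sub_le`). Averaging over s, dividing
by δ and letting δ → 0 yields the energy inequality, because translations in time are continuous in
L² (`sub_le_integral_inner_of_increments`). -/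

/-! ### Time translations in L² and the limit of infinitesimal increments -/

/-- Composition with a continuous family of measure preserving maps is continuous in `Lᵖ`. -/
theorem tendsto_eLpNorm_comp_sub {Z X E : Type*} [TopologicalSpace Z] [TopologicalSpace X]
    [R1Space X] [MeasurableSpace X] [BorelSpace X] [NormedAddCommGroup E] {μ : Measure X}
    [IsLocallyFiniteMeasure μ] [μ.InnerRegularCompactLTTop] {p : ℝ≥0∞} [Fact (1 ≤ p)]
    (hp : p ≠ ⊤) {g : Z → C(X, X)} (hg : Continuous g)
    (hgm : ∀ z, MeasurePreserving (g z) μ μ) {f : X → E} (hf : MemLp f p μ) (z₀ : Z) :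
    Tendsto (fun z => eLpNorm (fun x => f (g z x) - f (g z₀ x)) p μ) (𝓝 z₀) (𝓝 0) := by
  have hc := (continuous_const (y := hf.toLp f)).compMeasurePreservingLp hg hgm hp
  have h1 := tendsto_iff_edist_tendsto_0.1 (hc.tendsto z₀)
  refine h1.congr fun z => ?_
  rw [Lp.toLp_compMeasurePreserving, Lp.toLp_compMeasurePreserving, Lp.edist_toLp_toLp]
  rfl

theorem MeasureTheory.MemLp.integrable_inner_real {α E : Type*} [MeasurableSpace α] {μ : Measure α}
    [NormedAddCommGroup E] [InnerProductSpace ℝ E] {f g : α → E} (hf : MemLp f 2 μ)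
    (hg : MemLp g 2 μ) : Integrable (fun x => inner ℝ (f x) (g x)) μ :=
  (hf.norm.integrable_mul hg.norm).mono' (hf.1.inner hg.1)
    (ae_of_all _ fun _ => norm_inner_le_norm _ _)

theorem measurePreserving_translate_fst {X : Type*} [MeasurableSpace X] {μ : Measure X} [SFinite μ]
    (r : ℝ) :
    MeasurePreserving (fun z : ℝ × X => (z.1 + r, z.2)) (volume.prod μ) (volume.prod μ) :=
  (measurePreserving_add_right volume r).prod (MeasurePreserving.id μ)

theorem integral_spaceTimeMeasure_eq_translate {X : Type*} [MeasurableSpace X] {μ : Measure X}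
    [SFinite μ] (F : ℝ × X → ℝ) (s δ : ℝ) :
    ∫ z, F z ∂(spaceTimeMeasure μ s (s + δ)) =
      ∫ y, F (s + y.1, y.2) ∂((volume.restrict (Ioo 0 δ)).prod μ) := by
  have h1 : MeasurePreserving (MeasurableEquiv.addLeft s) (volume.restrict (Ioo 0 δ))
      (volume.restrict (Ioo s (s + δ))) := by
    have := (measurePreserving_add_left volume s).restrict_preimage
      (measurableSet_Ioo (a := s) (b := s + δ))
    simpa using! this
  have h2 := h1.prod (MeasurePreserving.id μ)
  exact (h2.integral_comp ((MeasurableEquiv.addLeft s).prodCongr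
    (MeasurableEquiv.refl X)).measurableEmbedding F).symm

/-- The shear (r, t, x) ↦ (r, t + r, x) preserves the product measure. Finiteness of ν keeps both
factors square integrable when the variable r is added. -/
theorem integrable_inner_shear {X E : Type*} [MeasurableSpace X] {μ : Measure X} [SFinite μ]
    [NormedAddCommGroup E] [InnerProductSpace ℝ E] {P Q : ℝ × X → E} (hP : MemLp P 2 (volume.prod μ))
    (hQ : MemLp Q 2 (volume.prod μ)) (ν : Measure ℝ) [IsFiniteMeasure ν] :
    Integrable (fun q : ℝ × (ℝ × X) => inner ℝ (Q q.2) (P (q.2.1 + q.1, q.2.2)))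
      (ν.prod (volume.prod μ)) := by
  have hm : MeasurePreserving (fun q : ℝ × (ℝ × X) => (q.1, (q.2.1 + q.1, q.2.2)))
      (ν.prod (volume.prod μ)) (ν.prod (volume.prod μ)) :=
    (MeasurePreserving.id ν).skew_product (g := fun r (z : ℝ × X) => (z.1 + r, z.2)) (by fun_prop)
      (ae_of_all _ fun r => (measurePreserving_translate_fst r).map_eq)
  exact (hQ.comp_snd ν).integrable_inner_real ((hP.comp_snd ν).comp_measurePreserving hm)

theorem measurePreserving_prod_rotate {A B C : Type*} [MeasurableSpace A] [MeasurableSpace B]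
    [MeasurableSpace C] (α : Measure A) (β : Measure B) (γ : Measure C) [SFinite α] [SFinite β]
    [SFinite γ] :
    MeasurePreserving (fun q : B × (A × C) => (q.2.1, (q.1, q.2.2))) (β.prod (α.prod γ))
      (α.prod (β.prod γ)) :=
  (measurePreserving_prodAssoc α β γ).comp
    (((Measure.measurePreserving_swap (μ := β) (ν := α)).prod (MeasurePreserving.id γ)).comp
      (measurePreserving_prodAssoc β α γ).symm)

theorem integrable_inner_shear_rotate {X E : Type*} [MeasurableSpace X] {μ : Measure X} [SFinite μ]
    [NormedAddCommGroup E] [InnerProductSpace ℝ E] {P Q : ℝ × X → E}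
    (hP : MemLp P 2 (volume.prod μ)) (hQ : MemLp Q 2 (volume.prod μ)) (ν : Measure ℝ)
    [IsFiniteMeasure ν] :
    Integrable (fun q : ℝ × (ℝ × X) => inner ℝ (Q (q.1, q.2.2)) (P (q.1 + q.2.1, q.2.2)))
      (volume.prod (ν.prod μ)) :=
  (measurePreserving_prod_rotate ν volume μ).integrable_comp_of_integrable
    (integrable_inner_shear hP hQ ν)

/-- Fubini after rotating the variables: averaging over the freezing time s first leaves a function
of the time lag r alone, the correlation of Q with the translate of P. -/
theorem integral_integral_inner_shear {X E : Type*} [MeasurableSpace X] {μ : Measure X} [SFinite μ]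
    [NormedAddCommGroup E] [InnerProductSpace ℝ E] {P Q : ℝ × X → E}
    (hP : MemLp P 2 (volume.prod μ)) (hQ : MemLp Q 2 (volume.prod μ)) (ν : Measure ℝ)
    [IsFiniteMeasure ν] :
    ∫ s, ∫ y, inner ℝ (Q (s, y.2)) (P (s + y.1, y.2)) ∂(ν.prod μ) =
      ∫ r, ∫ z, inner ℝ (Q z) (P (z.1 + r, z.2)) ∂(volume.prod μ) ∂ν := by
  have h1 := integrable_inner_shear hP hQ ν
  have hm := measurePreserving_prod_rotate ν (volume : Measure ℝ) μ
  rw [integral_integral (f := fun r (z : ℝ × X) => inner ℝ (Q z) (P (z.1 + r, z.2))) h1,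
    integral_integral (f := fun s (y : ℝ × X) => inner ℝ (Q (s, y.2)) (P (s + y.1, y.2)))
      (integrable_inner_shear_rotate hP hQ ν), ← hm.map_eq, integral_map hm.aemeasurable]
  rw [hm.map_eq]
  exact h1.aestronglyMeasurable

section Shear

variable {X E : Type*} [PseudoMetricSpace X] [SecondCountableTopology X] [LocallyCompactSpace X]
  [MeasurableSpace X] [BorelSpace X] {μ : Measure X} [IsLocallyFiniteMeasure μ]
  [NormedAddCommGroup E] [InnerProductSpace ℝ E]

/-- The correlation is the L² inner product of a fixed element with a translate, and translation is
continuous into L². This supplies the continuity at lag zero that the limit δ → 0 requires. -/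
theorem continuous_integral_inner_translate {P Q : ℝ × X → E} (hP : MemLp P 2 (volume.prod μ))
    (hQ : MemLp Q 2 (volume.prod μ)) :
    Continuous fun r : ℝ => ∫ z, inner ℝ (Q z) (P (z.1 + r, z.2)) ∂(volume.prod μ) := by
  let g : C(ℝ, C(ℝ × X, ℝ × X)) :=
    (ContinuousMap.mk (fun q : ℝ × (ℝ × X) => (q.2.1 + q.1, q.2.2)) (by fun_prop)).curry
  have hgm : ∀ r, MeasurePreserving (g r) (volume.prod μ) (volume.prod μ) :=
    fun r => measurePreserving_translate_fst r
  have hc := (continuous_const (y := hP.toLp P)).compMeasurePreservingLp g.continuous hgm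
    ENNReal.ofNat_ne_top
  have h2 := (continuous_const (y := hQ.toLp Q)).inner (𝕜 := ℝ) hc
  refine h2.congr fun r => ?_
  rw [Lp.toLp_compMeasurePreserving, L2.inner_def]
  refine integral_congr_ae ?_
  filter_upwards [hQ.coeFn_toLp, (hP.comp_measurePreserving (hgm r)).coeFn_toLp] with z h1 h2
  rw [h1, h2]
  rfl

end Shear

/-- If the increments of a continuous function over all small steps are bounded, in the mean,
by the integral of a continuous function, then so is its derivative. -/
theorem sub_le_of_forall_integral_sub_le {Y J : ℝ → ℝ} (hY : Continuous Y) (hJ : Continuous J)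
    {a b : ℝ} (h : ∀ δ > 0, ∫ s in a..b, (Y s - Y (s + δ)) ≤ ∫ r in 0..δ, J r) :
    Y a - Y b ≤ J 0 := by
  have hd : ∀ {g : ℝ → ℝ}, Continuous g → ∀ c,
      Tendsto (fun δ => δ⁻¹ * ∫ r in c..(c + δ), g r) (𝓝[>] 0) (𝓝 (g c)) := by
    intro g hg c
    have := (intervalIntegral.integral_hasDerivAt_right (hg.intervalIntegrable c c)
      (hg.stronglyMeasurableAtFilter _ _) hg.continuousAt).tendsto_slope_zero_right
    simpa using this
  have h1 := ((hd hY a).sub (hd hY b))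
  have h2 := hd hJ 0
  refine le_of_tendsto_of_tendsto h1 h2 ?_
  filter_upwards [self_mem_nhdsWithin] with δ (hδ : 0 < δ)
  rw [← mul_sub]
  refine mul_le_mul_of_nonneg_left ?_ (inv_nonneg.2 hδ.le)
  refine le_trans (le_of_eq ?_) ((h δ hδ).trans_eq (by simp))
  have hi : ∀ x y, IntervalIntegrable Y volume x y := fun x y => hY.intervalIntegrable x y
  rw [intervalIntegral.integral_sub (hi _ _)
    (Continuous.intervalIntegrable (by fun_prop) _ _),
    intervalIntegral.integral_comp_add_right]
  -- The mean increment telescopes: it equals the integral of Y over (a, a + δ) minus that over (b,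
  -- b + δ).
  have e1 := intervalIntegral.integral_add_adjacent_intervals (hi a (a + δ)) (hi (a + δ) (b + δ))
  have e2 := intervalIntegral.integral_add_adjacent_intervals (hi a b) (hi b (b + δ))
  linarith

section Shear

variable {X E E' : Type*} [PseudoMetricSpace X] [SecondCountableTopology X] [LocallyCompactSpace X]
  [MeasurableSpace X] [BorelSpace X] {μ : Measure X} [IsLocallyFiniteMeasure μ]
  [NormedAddCommGroup E] [InnerProductSpace ℝ E] [NormedAddCommGroup E'] [InnerProductSpace ℝ E']

/-- A one-sided estimate of the increments of `Y` by integrals in which one factor is frozen at the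
initial time passes to the limit of infinitesimal increments. -/
theorem sub_le_integral_inner_of_increments {P Q : ℝ × X → E} {P' Q' : ℝ × X → E'}
    {a b : ℝ} (hab : a ≤ b)
    (hP : MemLp P 2 (volume.prod μ)) (hQ : MemLp Q 2 (spaceTimeMeasure μ a b))
    (hP' : MemLp P' 2 (volume.prod μ)) (hQ' : MemLp Q' 2 (spaceTimeMeasure μ a b))
    {Y : ℝ → ℝ} (hY : Continuous Y)
    (h : ∀ᵐ s ∂(volume.restrict (Ioo a b)), ∀ δ > 0,
      Y s - Y (s + δ) ≤ ∫ z, inner ℝ (Q (s, z.2)) (P z) ∂(spaceTimeMeasure μ s (s + δ)) +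
        ∫ z, inner ℝ (Q' (s, z.2)) (P' z) ∂(spaceTimeMeasure μ s (s + δ))) :
    Y a - Y b ≤ ∫ z, inner ℝ (Q z) (P z) ∂(spaceTimeMeasure μ a b) +
      ∫ z, inner ℝ (Q' z) (P' z) ∂(spaceTimeMeasure μ a b) := by
  set S : Set (ℝ × X) := Ioo a b ×ˢ univ with hS
  have hSm : MeasurableSet S := measurableSet_Ioo.prod MeasurableSet.univ
  have hSr : spaceTimeMeasure μ a b = (volume.prod μ).restrict S := by
    rw [spaceTimeMeasure, hS, ← Measure.prod_restrict, Measure.restrict_univ]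
  -- The frozen factors are extended by zero outside (a, b), so that translations act on the whole
  -- time line.
  have hR := (memLp_indicator_iff_restrict hSm).2 (hSr ▸ hQ)
  have hR' := (memLp_indicator_iff_restrict hSm).2 (hSr ▸ hQ')
  have hcJ := (continuous_integral_inner_translate hP hR).add
    (continuous_integral_inner_translate hP' hR')
  refine (sub_le_of_forall_integral_sub_le (a := a) (b := b) hY hcJ ?_).trans_eq ?_
  · intro δ hδ
    have hνJ := continuous_integral_inner_translate hP hR
    have hνJ' := continuous_integral_inner_translate hP' hR'
    simp only [Pi.add_apply]
    rw [intervalIntegral.integral_add (hνJ.intervalIntegrable _ _)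
      (hνJ'.intervalIntegrable _ _), intervalIntegral.integral_of_le hδ.le,
      intervalIntegral.integral_of_le hδ.le, integral_Ioc_eq_integral_Ioo,
      integral_Ioc_eq_integral_Ioo,
      ← integral_integral_inner_shear hP hR, ← integral_integral_inner_shear hP' hR',
      ← integral_add]
    rotate_left
    · exact (integrable_inner_shear_rotate hP hR _).integral_prod_left
    · exact (integrable_inner_shear_rotate hP' hR' _).integral_prod_left
    rw [intervalIntegral.integral_of_le hab, integral_Ioc_eq_integral_Ioo]
    -- The zero extension confines the freezing time to (a, b), which is where the increment
    -- hypothesis is available.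
    have hz : ∀ s ∉ Ioo a b, (∫ y, inner ℝ (S.indicator Q (s, y.2)) (P (s + y.1, y.2))
          ∂((volume.restrict (Ioo 0 δ)).prod μ)) + ∫ y, inner ℝ (S.indicator Q' (s, y.2))
            (P' (s + y.1, y.2)) ∂((volume.restrict (Ioo 0 δ)).prod μ) = 0 := by
      intro s hs
      have : ∀ x : X, (s, x) ∉ S := fun x hx => hs hx.1
      simp [this]
    rw [← setIntegral_eq_integral_of_forall_compl_eq_zero hz]
    refine integral_mono_ae ?_ ?_ ?_
    · refine (Continuous.integrableOn_Icc (by fun_prop)).mono_set Ioo_subset_Icc_self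
    · exact ((integrable_inner_shear_rotate hP hR _).integral_prod_left.add
        (integrable_inner_shear_rotate hP' hR' _).integral_prod_left).integrableOn
    · filter_upwards [h, ae_restrict_mem measurableSet_Ioo] with s hs hsI
      refine (hs δ hδ).trans_eq ?_
      have hmem : ∀ x : X, (s, x) ∈ S := fun x => ⟨hsI, trivial⟩
      simp only [integral_spaceTimeMeasure_eq_translate, hmem, indicator_of_mem]
  · simp only [Pi.add_apply, add_zero, hSr]
    rw [← integral_indicator hSm, ← integral_indicator hSm]
    congr 2 <;>
    · ext z
      by_cases hz : z ∈ S <;> simp [hz]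

end Shear

/-! ### Mollification in L¹ -/

section Mollification

open scoped Convolution

variable {G E : Type*} [NormedAddCommGroup G] [NormedSpace ℝ G] [FiniteDimensional ℝ G]
  [MeasurableSpace G] [BorelSpace G] {μ : Measure G} [μ.IsAddHaarMeasure]
  [NormedAddCommGroup E] [NormedSpace ℝ E] [CompleteSpace E]

theorem lintegral_enorm_normed_contDiffBump (φ : ContDiffBump (0 : G)) :
    ∫⁻ y, ‖φ.normed μ y‖ₑ ∂μ = 1 := by
  have h : ∀ y, ‖φ.normed μ y‖ₑ = ENNReal.ofReal (φ.normed μ y) := fun y =>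
    Real.enorm_of_nonneg (φ.nonneg_normed y)
  simp_rw [h]
  rw [← ofReal_integral_eq_lintegral_ofReal φ.integrable_normed
    (ae_of_all _ φ.nonneg_normed), φ.integral_normed, ENNReal.ofReal_one]

/-- The kernel has mass one, so f x can be moved under the convolution integral. -/
theorem enorm_normed_convolution_sub_le (φ : ContDiffBump (0 : G)) {f : G → E}
    (hf : Integrable f μ) (x : G) :
    ‖(φ.normed μ ⋆[ContinuousLinearMap.lsmul ℝ ℝ, μ] f) x - f x‖ₑ ≤
      ∫⁻ y, ‖φ.normed μ y‖ₑ * ‖f (x - y) - f x‖ₑ ∂μ := by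
  have h1 : Integrable (fun y => φ.normed μ y • f (x - y)) μ :=
    (φ.hasCompactSupport_normed.convolutionExists_left (ContinuousLinearMap.lsmul ℝ ℝ)
      φ.continuous_normed hf.locallyIntegrable x)
  have h2 : Integrable (fun y => φ.normed μ y • f x) μ := φ.integrable_normed.smul_const _
  have h3 : (φ.normed μ ⋆[ContinuousLinearMap.lsmul ℝ ℝ, μ] f) x - f x =
      ∫ y, φ.normed μ y • (f (x - y) - f x) ∂μ := by
    simp_rw [smul_sub]
    rw [integral_sub h1 h2, integral_smul_const, φ.integral_normed, one_smul]
    rfl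
  rw [h3]
  refine (enorm_integral_le_lintegral_enorm _).trans_eq ?_
  simp_rw [enorm_smul]

/-- Mollifications of an integrable function converge to it in mean. -/
theorem tendsto_lintegral_normed_convolution_sub {φ : ℕ → ContDiffBump (0 : G)}
    (hφ : Tendsto (fun i => (φ i).rOut) atTop (𝓝 0)) {f : G → E} (hf : Integrable f μ) :
    Tendsto (fun i => ∫⁻ x, ‖((φ i).normed μ ⋆[ContinuousLinearMap.lsmul ℝ ℝ, μ] f) x - f x‖ₑ ∂μ)
      atTop (𝓝 0) := by
  let g : C(G, C(G, G)) := (ContinuousMap.mk (fun q : G × G => q.2 - q.1) (by fun_prop)).curry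
  have hgm : ∀ y, MeasurePreserving (g y) μ μ := fun y => measurePreserving_sub_right μ y
  have hT := tendsto_eLpNorm_comp_sub (p := 1) ENNReal.one_ne_top g.continuous hgm
    (memLp_one_iff_integrable.2 hf) 0
  simp only [eLpNorm_one_eq_lintegral_enorm] at hT
  replace hT : Tendsto (fun y => ∫⁻ x, ‖f (x - y) - f x‖ₑ ∂μ) (𝓝 0) (𝓝 0) := by
    refine hT.congr fun y => ?_
    simp [g]
  rw [ENNReal.tendsto_nhds_zero] at hT ⊢
  intro ε hε
  obtain ⟨r, hr, hball⟩ := Metric.eventually_nhds_iff_ball.1 (hT ε hε)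
  filter_upwards [hφ.eventually (gt_mem_nhds hr)] with i hi
  have hm : AEMeasurable (Function.uncurry fun x y =>
      ‖(φ i).normed μ y‖ₑ * ‖f (x - y) - f x‖ₑ) (μ.prod μ) := by
    have h1 : AEMeasurable (fun q : G × G => ‖(φ i).normed μ q.2‖ₑ) (μ.prod μ) :=
      ((φ i).continuous_normed.comp continuous_snd).measurable.enorm.aemeasurable
    refine h1.mul ?_
    · refine AEStronglyMeasurable.enorm (AEStronglyMeasurable.sub ?_ ?_)
      · exact hf.1.comp_quasiMeasurePreserving (quasiMeasurePreserving_sub μ μ)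
      · exact hf.1.comp_fst
  calc ∫⁻ x, ‖((φ i).normed μ ⋆[ContinuousLinearMap.lsmul ℝ ℝ, μ] f) x - f x‖ₑ ∂μ
      ≤ ∫⁻ x, ∫⁻ y, ‖(φ i).normed μ y‖ₑ * ‖f (x - y) - f x‖ₑ ∂μ ∂μ :=
        lintegral_mono fun x => enorm_normed_convolution_sub_le (φ i) hf x
    _ = ∫⁻ y, ∫⁻ x, ‖(φ i).normed μ y‖ₑ * ‖f (x - y) - f x‖ₑ ∂μ ∂μ := lintegral_lintegral_swap hm
    _ ≤ ∫⁻ y, ‖(φ i).normed μ y‖ₑ * ε ∂μ := by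
        refine lintegral_mono fun y => ?_
        rw [lintegral_const_mul' _ _ enorm_ne_top]
        -- Only shifts in the support of the kernel count, and for these continuity of translations
        -- in L¹ applies.
        by_cases hy : y ∈ Metric.ball (0 : G) (φ i).rOut
        · gcongr
          exact hball y (Metric.ball_subset_ball hi.le hy)
        · rw [← (φ i).support_normed_eq (μ := μ), Function.notMem_support] at hy
          simp [hy]
    _ = ε := by
        rw [lintegral_mul_const _ (φ i).continuous_normed.measurable.enorm,
          lintegral_enorm_normed_contDiffBump, one_mul]

end Mollification

/-! ### Weak gradients: product rule, differences and mollification -/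

section WeakGradient

open scoped Convolution

variable {n : ℕ}

theorem gradient_mul {f g : Euc n → ℝ} {x : Euc n} (hf : DifferentiableAt ℝ f x)
    (hg : DifferentiableAt ℝ g x) :
    gradient (fun y => f y * g y) x = f x • gradient g x + g x • gradient f x := by
  simp only [gradient]
  rw [fderiv_fun_mul hf hg]
  simp

theorem gradient_eq_zero_of_notMem_tsupport {f : Euc n → ℝ} {x : Euc n} (hx : x ∉ tsupport f) :
    gradient f x = 0 := by
  have : fderiv ℝ f x = 0 := image_eq_zero_of_notMem_tsupport
    (fun h => hx (tsupport_fderiv_subset ℝ h))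
  simp [gradient, this]

theorem ContDiff.continuous_gradient {f : Euc n → ℝ} {k : WithTop ℕ∞} (hf : ContDiff ℝ k f)
    (hk : k ≠ 0) : Continuous (gradient f) :=
  (InnerProductSpace.toDual ℝ (Euc n)).symm.continuous.comp (hf.continuous_fderiv hk)

theorem norm_gradient (f : Euc n → ℝ) (x : Euc n) : ‖gradient f x‖ = ‖fderiv ℝ f x‖ := by
  simp [gradient]

/-- On the compact set K the function v is integrable and ψ is bounded, while off K the product
vanishes. -/
theorem MeasureTheory.LocallyIntegrableOn.integrable_smul_of_tsupport_subset {E : Type*}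
    [NormedAddCommGroup E] [NormedSpace ℝ E] {Ω K : Set (Euc n)} {v : Euc n → E}
    (hv : LocallyIntegrableOn v Ω volume) {ψ : Euc n → ℝ} (hψ : Continuous ψ) (hK : IsCompact K)
    (hKΩ : K ⊆ Ω) (hs : ∀ x ∉ K, ψ x = 0) : Integrable (fun x => ψ x • v x) volume := by
  have h1 := (hv.integrableOn_compact_subset hKΩ hK).continuousOn_smul hψ.continuousOn hK
  rw [← integrable_indicator_iff hK.measurableSet] at h1
  refine h1.congr (ae_of_all _ fun x => ?_)
  by_cases hx : x ∈ K <;> simp [hx, hs x]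

theorem MeasureTheory.LocallyIntegrableOn.integrable_smul_vector_of_tsupport_subset
    {Ω K : Set (Euc n)} {v : Euc n → ℝ}
    (hv : LocallyIntegrableOn v Ω volume) {ψ : Euc n → Euc n} (hψ : Continuous ψ)
    (hK : IsCompact K) (hKΩ : K ⊆ Ω) (hs : ∀ x ∉ K, ψ x = 0) :
    Integrable (fun x => v x • ψ x) volume := by
  have h1 := (hv.integrableOn_compact_subset hKΩ hK).smul_continuousOn hψ.continuousOn hK
  rw [← integrable_indicator_iff hK.measurableSet] at h1
  refine h1.congr (ae_of_all _ fun x => ?_)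
  by_cases hx : x ∈ K <;> simp [hx, hs x]

/-- The product rule for a weakly differentiable function and a smooth function, tested on a
function such that the product of the two smooth functions is supported in the domain. -/
theorem HasWeakGradientOn.integral_mul_smul_gradient {Ω : Set (Euc n)} {v : Euc n → ℝ}
    {G : Euc n → Euc n} (h : HasWeakGradientOn Ω v G) {ζ φ : Euc n → ℝ} (hζ : ContDiff ℝ ∞ ζ)
    (hφ : ContDiff ℝ ∞ φ) (hφc : HasCompactSupport φ) (hs : tsupport ζ ∩ tsupport φ ⊆ Ω) :
    ∫ x in Ω, (v x * ζ x) • gradient φ x =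
      -∫ x in Ω, φ x • (ζ x • G x + v x • gradient ζ x) := by
  have hK : IsCompact (tsupport ζ ∩ tsupport φ) := hφc.isCompact.inter_left (isClosed_tsupport ζ)
  have hgζ := hζ.continuous_gradient (by simp)
  have hgφ := hφ.continuous_gradient (by simp)
  have i1 : Integrable (fun x => v x • (ζ x • gradient φ x)) volume := by
    refine h.1.integrable_smul_vector_of_tsupport_subset (hζ.continuous.smul hgφ) hK hs
      fun x hx => ?_
    by_cases h1 : x ∈ tsupport ζ
    · simp [gradient_eq_zero_of_notMem_tsupport fun h2 => hx ⟨h1, h2⟩]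
    · simp [image_eq_zero_of_notMem_tsupport h1]
  have i2 : Integrable (fun x => v x • (φ x • gradient ζ x)) volume := by
    refine h.1.integrable_smul_vector_of_tsupport_subset (hφ.continuous.smul hgζ) hK hs
      fun x hx => ?_
    by_cases h1 : x ∈ tsupport φ
    · simp [gradient_eq_zero_of_notMem_tsupport fun h2 => hx ⟨h2, h1⟩]
    · simp [image_eq_zero_of_notMem_tsupport h1]
  have i3 : Integrable (fun x => (ζ x * φ x) • G x) volume := by
    refine h.2.1.integrable_smul_of_tsupport_subset (hζ.continuous.mul hφ.continuous) hK hs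
      fun x hx => ?_
    by_cases h1 : x ∈ tsupport ζ
    · simp [image_eq_zero_of_notMem_tsupport fun h2 => hx ⟨h1, h2⟩]
    · simp [image_eq_zero_of_notMem_tsupport h1]
  have hts : tsupport (fun x => ζ x * φ x) ⊆ tsupport ζ ∩ tsupport φ :=
    subset_inter (tsupport_mul_subset_left) (tsupport_mul_subset_right)
  have key := h.2.2 (fun x => ζ x * φ x) (hζ.mul hφ)
    (hφc.mono' (hts.trans inter_subset_right |> (subset_tsupport _).trans)) (hts.trans hs)
  have e1 : ∀ x, v x • gradient (fun x => ζ x * φ x) x =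
      v x • (ζ x • gradient φ x) + v x • (φ x • gradient ζ x) := fun x => by
    rw [gradient_mul (hζ.differentiable (by simp) x) (hφ.differentiable (by simp) x), smul_add]
  have e2 : ∀ x, φ x • (ζ x • G x + v x • gradient ζ x) =
      (ζ x * φ x) • G x + v x • (φ x • gradient ζ x) := fun x => by
    rw [smul_add, smul_smul, mul_comm (φ x), smul_comm (φ x)]
  simp_rw [e1] at key
  simp_rw [e2, mul_smul (v _)]
  rw [integral_add i1.integrableOn i2.integrableOn] at key
  rw [integral_add i3.integrableOn i2.integrableOn, neg_add, ← key]
  abel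

/-- The product rule for a weakly differentiable function and a smooth function. -/
theorem HasWeakGradientOn.mul_smooth {Ω : Set (Euc n)} {v : Euc n → ℝ} {G : Euc n → Euc n}
    (h : HasWeakGradientOn Ω v G) (hΩ : IsOpen Ω) {ζ : Euc n → ℝ} (hζ : ContDiff ℝ ∞ ζ) :
    HasWeakGradientOn Ω (fun x => v x * ζ x) (fun x => ζ x • G x + v x • gradient ζ x) := by
  have hgζ := hζ.continuous_gradient (by simp)
  refine ⟨?_, ?_, fun φ hφ hφc hφΩ =>
    h.integral_mul_smul_gradient hζ hφ hφc (inter_subset_right.trans hφΩ)⟩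
  · exact h.1.mul_continuousOn hζ.continuous.continuousOn hΩ.isLocallyClosed
  · exact (h.2.1.continuousOn_smul hΩ.isLocallyClosed hζ.continuous.continuousOn).add
      (h.1.smul_continuousOn hΩ.isLocallyClosed hgζ.continuousOn)

theorem HasWeakGradientOn.sub {Ω : Set (Euc n)} {v₁ v₂ : Euc n → ℝ}
    {G₁ G₂ : Euc n → Euc n} (h₁ : HasWeakGradientOn Ω v₁ G₁) (h₂ : HasWeakGradientOn Ω v₂ G₂) :
    HasWeakGradientOn Ω (v₁ - v₂) (G₁ - G₂) := by
  refine ⟨h₁.1.sub h₂.1, h₁.2.1.sub h₂.2.1, fun φ hφ hφc hφΩ => ?_⟩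
  have hg := hφ.continuous_gradient (by simp)
  have i : ∀ {v : Euc n → ℝ}, LocallyIntegrableOn v Ω volume →
      IntegrableOn (fun x => v x • gradient φ x) Ω volume := fun hv =>
    (hv.integrable_smul_vector_of_tsupport_subset hg hφc hφΩ
      fun x hx => gradient_eq_zero_of_notMem_tsupport hx).integrableOn
  have j : ∀ {G : Euc n → Euc n}, LocallyIntegrableOn G Ω volume →
      IntegrableOn (fun x => φ x • G x) Ω volume := fun hG =>
    (hG.integrable_smul_of_tsupport_subset hφ.continuous hφc hφΩ
      fun x hx => image_eq_zero_of_notMem_tsupport hx).integrableOn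
  simp only [Pi.sub_apply, sub_smul, smul_sub]
  rw [integral_sub (i h₁.1) (i h₂.1), integral_sub (j h₁.2.1) (j h₂.2.1),
    h₁.2.2 φ hφ hφc hφΩ, h₂.2.2 φ hφ hφc hφΩ]
  abel

/-- Mollification commutes with weak differentiation. -/
theorem HasWeakGradientOn.hasGradientAt_convolution {v : Euc n → ℝ} {G : Euc n → Euc n}
    (h : HasWeakGradientOn univ v G) {ρ : Euc n → ℝ} (hρ : ContDiff ℝ ∞ ρ)
    (hρc : HasCompactSupport ρ) (x : Euc n) :
    HasGradientAt (ρ ⋆[ContinuousLinearMap.lsmul ℝ ℝ, volume] v)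
      ((ρ ⋆[ContinuousLinearMap.lsmul ℝ ℝ, volume] G) x) x := by
  have hv := locallyIntegrableOn_univ.1 h.1
  have hd := hρc.hasFDerivAt_convolution_left (ContinuousLinearMap.lsmul ℝ ℝ)
    (hρ.of_le (by simp)) hv x
  rw [hasGradientAt_iff_hasFDerivAt]
  refine hd.congr_fderiv ?_
  ext e
  -- The definition of the weak gradient is tested on y ↦ ρ (x - y), whose gradient in y is the
  -- reflected gradient of the kernel. This moves the derivative from ρ to v.
  have hφ : ContDiff ℝ ∞ fun y => ρ (x - y) := hρ.comp (contDiff_const.sub contDiff_id)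
  have hφc : HasCompactSupport fun y => ρ (x - y) :=
    hρc.comp_homeomorph (Homeomorph.subLeft x)
  have hg := hφ.continuous_gradient (by simp)
  have key := h.2.2 _ hφ hφc (subset_univ _)
  rw [setIntegral_univ, setIntegral_univ] at key
  have hgrad : ∀ y, inner ℝ e (gradient (fun y => ρ (x - y)) y) = -(fderiv ℝ ρ (x - y) e) := by
    intro y
    have h1 : HasFDerivAt (fun y => ρ (x - y)) (-(fderiv ℝ ρ (x - y))) y := by
      have := ((hρ.differentiable (by simp)) (x - y)).hasFDerivAt.comp y
        ((hasFDerivAt_const x y).sub (hasFDerivAt_id y))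
      convert! this using 1
      ext; simp
    rw [real_inner_comm, inner_gradient_left, h1.fderiv]
    rfl
  have iv : Integrable (fun y => v y • gradient (fun y => ρ (x - y)) y) volume :=
    h.1.integrable_smul_vector_of_tsupport_subset hg hφc (subset_univ _)
      fun y hy => gradient_eq_zero_of_notMem_tsupport hy
  have hex : ConvolutionExistsAt (fderiv ℝ ρ) v x
      ((ContinuousLinearMap.lsmul ℝ ℝ).precompL (Euc n)) volume :=
    (hρc.fderiv ℝ).convolutionExists_left _ (hρ.continuous_fderiv (by simp)) hv x
  have hR : (ρ ⋆[ContinuousLinearMap.lsmul ℝ ℝ, volume] G) x = ∫ y, ρ (x - y) • G y := by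
    rw [convolution_eq_swap]
    rfl
  rw [← neg_eq_iff_eq_neg] at key
  rw [InnerProductSpace.toDual_apply_apply, real_inner_comm, hR, ← key, inner_neg_right,
    ← integral_inner iv, convolution_eq_swap, ContinuousLinearMap.integral_apply]
  · simp only [inner_smul_right, hgrad]
    rw [← integral_neg]
    congr 1
    ext y
    simp [mul_comm]
  · exact hex.integrable_swap

end WeakGradient

/-! ### The chain rule for weak gradients -/

section ChainRule

open scoped Convolution

variable {n : ℕ}

/-- The bounded ratio of the radii is what gives almost everywhere convergence of the mollifications
of a merely locally integrable function. -/
theorem exists_contDiffBump_sequence (G : Type*) [NormedAddCommGroup G] :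
    ∃ φ : ℕ → ContDiffBump (0 : G), Tendsto (fun i => (φ i).rOut) atTop (𝓝 0) ∧
      ∀ i, (φ i).rOut ≤ 2 * (φ i).rIn := by
  refine ⟨fun i => ⟨1 / ((i : ℝ) + 1), 2 * (1 / ((i : ℝ) + 1)), by positivity, ?_⟩, ?_,
    fun i => le_rfl⟩
  · have : 0 < 1 / ((i : ℝ) + 1) := by positivity
    linarith
  · simpa using (tendsto_one_div_add_atTop_nhds_zero_nat (𝕜 := ℝ)).const_mul 2

/-- The smooth case is classical integration by parts in each direction e, the vector identity being
recovered by pairing with arbitrary e. -/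
theorem integral_comp_smul_gradient_of_contDiff {v : Euc n → ℝ} {G : Euc n → Euc n}
    (hv : Continuous v) (hG : Continuous G) (h : ∀ x, HasGradientAt v (G x) x) {η : ℝ → ℝ}
    (hη : ContDiff ℝ 1 η) {φ : Euc n → ℝ} (hφ : ContDiff ℝ ∞ φ) (hφc : HasCompactSupport φ) :
    ∫ x, η (v x) • gradient φ x = -∫ x, φ x • (deriv η (v x) • G x) := by
  have hgφ := hφ.continuous_gradient (by simp)
  have hdη : Continuous (deriv η) := hη.continuous_deriv le_rfl
  have hηv : ∀ x, HasFDerivAt (fun x => η (v x))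
      (deriv η (v x) • InnerProductSpace.toDual ℝ (Euc n) (G x)) x := fun x => by
    exact ((hη.differentiable (by simp)) (v x)).hasDerivAt.comp_hasFDerivAt x
      (hasGradientAt_iff_hasFDerivAt.1 (h x))
  have hgc : HasCompactSupport (gradient φ) :=
    hφc.mono' fun x hx => by_contra fun hn => hx (gradient_eq_zero_of_notMem_tsupport hn)
  have i1 : Integrable (fun x => η (v x) • gradient φ x) volume :=
    ((hη.continuous.comp hv).smul hgφ).integrable_of_hasCompactSupport hgc.smul_left
  have i2 : Integrable (fun x => φ x • (deriv η (v x) • G x)) volume :=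
    (hφ.continuous.smul ((hdη.comp hv).smul hG)).integrable_of_hasCompactSupport hφc.smul_right
  have i3 : Integrable (fun x => η (v x) * φ x) volume :=
    ((hη.continuous.comp hv).mul hφ.continuous).integrable_of_hasCompactSupport hφc.mul_left
  refine ext_inner_left ℝ fun e => ?_
  rw [inner_neg_right, ← integral_inner i1, ← integral_inner i2]
  have e1 : ∀ x, inner ℝ e (η (v x) • gradient φ x) = η (v x) * fderiv ℝ φ x e := fun x => by
    rw [inner_smul_right, real_inner_comm, inner_gradient_left]
  have e2 : ∀ x, inner ℝ e (φ x • (deriv η (v x) • G x)) =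
      fderiv ℝ (fun x => η (v x)) x e * φ x := fun x => by
    rw [(hηv x).fderiv, inner_smul_right, inner_smul_right, real_inner_comm]
    simp
    ring
  have j1 := (i1.const_inner (𝕜 := ℝ) e)
  have j2 := (i2.const_inner (𝕜 := ℝ) e)
  simp_rw [e1] at j1 ⊢
  simp_rw [e2] at j2 ⊢
  exact integral_mul_fderiv_eq_neg_fderiv_mul_of_integrable j2 j1 i3
    (fun x _ => (hηv x).differentiableAt) (fun x _ => (hφ.differentiable (by simp)) x)

/-- The chain rule for integrable functions with integrable weak gradient on the whole space. -/
theorem HasWeakGradientOn.integral_comp_smul_gradient {v : Euc n → ℝ} {G : Euc n → Euc n}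
    (h : HasWeakGradientOn univ v G) (hGi : Integrable G volume)
    {η : ℝ → ℝ} (hη : ContDiff ℝ 1 η) {B C : ℝ} (hB : ∀ a, |η a| ≤ B) (hC : ∀ a, |deriv η a| ≤ C)
    {φ : Euc n → ℝ} (hφ : ContDiff ℝ ∞ φ) (hφc : HasCompactSupport φ) :
    ∫ x, η (v x) • gradient φ x = -∫ x, φ x • (deriv η (v x) • G x) := by
  obtain ⟨ρ, hρ0, hρK⟩ := exists_contDiffBump_sequence (Euc n)
  have hv := locallyIntegrableOn_univ.1 h.1
  have hgφ := hφ.continuous_gradient (by simp)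
  have hdη : Continuous (deriv η) := hη.continuous_deriv le_rfl
  have hgc : HasCompactSupport (gradient φ) :=
    hφc.mono' fun x hx => by_contra fun hn => hx (gradient_eq_zero_of_notMem_tsupport hn)
  set vj : ℕ → Euc n → ℝ := fun i =>
    (ρ i).normed volume ⋆[ContinuousLinearMap.lsmul ℝ ℝ, volume] v with hvj
  set Gj : ℕ → Euc n → Euc n := fun i =>
    (ρ i).normed volume ⋆[ContinuousLinearMap.lsmul ℝ ℝ, volume] G with hGj
  have hvjc : ∀ i, Continuous (vj i) := fun i =>
    (ρ i).hasCompactSupport_normed.continuous_convolution_left _ (ρ i).continuous_normed hv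
  have hGjc : ∀ i, Continuous (Gj i) := fun i =>
    (ρ i).hasCompactSupport_normed.continuous_convolution_left _ (ρ i).continuous_normed
      hGi.locallyIntegrable
  have hgrad : ∀ i x, HasGradientAt (vj i) (Gj i x) x := fun i x =>
    h.hasGradientAt_convolution (ρ i).contDiff_normed (ρ i).hasCompactSupport_normed x
  have hae : ∀ᵐ x, Tendsto (fun i => vj i x) atTop (𝓝 (v x)) :=
    ContDiffBump.ae_convolution_tendsto_right_of_locallyIntegrable hρ0
      (Eventually.of_forall hρK) hv
  have hL1 := tendsto_lintegral_normed_convolution_sub hρ0 hGi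
  have hid : ∀ i, ∫ x, η (vj i x) • gradient φ x =
      -∫ x, φ x • (deriv η (vj i x) • Gj i x) := fun i =>
    integral_comp_smul_gradient_of_contDiff (hvjc i) (hGjc i) (hgrad i) hη hφ hφc
  have hlim1 : Tendsto (fun i => ∫ x, η (vj i x) • gradient φ x) atTop
      (𝓝 (∫ x, η (v x) • gradient φ x)) := by
    refine tendsto_integral_of_dominated_convergence (fun x => B * ‖gradient φ x‖) (fun i => ?_)
      ((hgφ.integrable_of_hasCompactSupport hgc).norm.const_mul B) (fun i => ?_) ?_
    · exact ((hη.continuous.comp (hvjc i)).smul hgφ).aestronglyMeasurable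
    · refine ae_of_all _ fun x => ?_
      rw [norm_smul]
      gcongr
      exact hB _
    · filter_upwards [hae] with x hx
      exact ((hη.continuous.tendsto _).comp hx).smul_const _
  obtain ⟨M, hM⟩ := hφc.exists_bound_of_continuous hφ.continuous
  have hM0 : 0 ≤ M := (norm_nonneg _).trans (hM 0)
  have hC0 : 0 ≤ C := (abs_nonneg _).trans (hC 0)
  have hmain : Tendsto (fun i => ∫ x, φ x • (deriv η (vj i x) • G x)) atTop
      (𝓝 (∫ x, φ x • (deriv η (v x) • G x))) := by
    refine tendsto_integral_of_dominated_convergence (fun x => M * (C * ‖G x‖)) (fun i => ?_)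
      ((hGi.norm.const_mul C).const_mul M) (fun i => ?_) ?_
    · exact hφ.continuous.aestronglyMeasurable.smul
        ((hdη.comp (hvjc i)).aestronglyMeasurable.smul hGi.1)
    · refine ae_of_all _ fun x => ?_
      rw [norm_smul, norm_smul]
      gcongr
      exacts [hM x, hC _]
    · filter_upwards [hae] with x hx
      exact (((hdη.tendsto _).comp hx).smul_const _).const_smul _
  -- The term η'(v_j) G_j is split as η'(v_j) (G_j - G) + η'(v_j) G. The first part vanishes by L¹
  -- convergence of the gradients, the second converges by domination, so no pointwise convergence
  -- of G_j is needed.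
  have herr : Tendsto (fun i => ∫ x, φ x • (deriv η (vj i x) • (Gj i x - G x))) atTop (𝓝 0) := by
    rw [tendsto_iff_edist_tendsto_0]
    simp only [edist_zero_right]
    have h0 : Tendsto (fun i => ENNReal.ofReal (M * C) * ∫⁻ x, ‖Gj i x - G x‖ₑ) atTop (𝓝 0) := by
      simpa using ENNReal.Tendsto.const_mul hL1 (Or.inr ENNReal.ofReal_ne_top)
    refine tendsto_of_tendsto_of_tendsto_of_le_of_le tendsto_const_nhds h0 (fun _ => zero_le)
      fun i => ?_
    refine (enorm_integral_le_lintegral_enorm _).trans ?_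
    rw [← lintegral_const_mul' _ _ ENNReal.ofReal_ne_top]
    refine lintegral_mono fun x => ?_
    rw [smul_smul, enorm_smul]
    gcongr
    rw [← ofReal_norm, norm_mul]
    gcongr
    exacts [hM x, hC _]
  have hlim2 : Tendsto (fun i => ∫ x, φ x • (deriv η (vj i x) • Gj i x)) atTop
      (𝓝 (∫ x, φ x • (deriv η (v x) • G x))) := by
    have := herr.add hmain
    rw [zero_add] at this
    refine this.congr fun i => ?_
    rw [← integral_add]
    · congr 1
      ext1 x
      rw [← smul_add, ← smul_add, sub_add_cancel]
    · have j1 : Integrable (fun x => φ x • (deriv η (vj i x) • Gj i x)) volume :=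
        (hφ.continuous.smul ((hdη.comp (hvjc i)).smul (hGjc i))).integrable_of_hasCompactSupport
          hφc.smul_right
      have j2 : Integrable (fun x => φ x • (deriv η (vj i x) • G x)) volume := by
        refine ((hGi.norm.const_mul C).const_mul M).mono'
          (hφ.continuous.aestronglyMeasurable.smul
            ((hdη.comp (hvjc i)).aestronglyMeasurable.smul hGi.1)) (ae_of_all _ fun x => ?_)
        rw [norm_smul, norm_smul]
        gcongr
        exacts [hM x, hC _]
      refine (j1.sub j2).congr (ae_of_all _ fun x => ?_)
      simp only [Pi.sub_apply, smul_sub]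
    · refine ((hGi.norm.const_mul C).const_mul M).mono'
          (hφ.continuous.aestronglyMeasurable.smul
            ((hdη.comp (hvjc i)).aestronglyMeasurable.smul hGi.1)) (ae_of_all _ fun x => ?_)
      rw [norm_smul, norm_smul]
      gcongr
      exacts [hM x, hC _]
  refine tendsto_nhds_unique hlim1 ?_
  simp_rw [hid]
  exact hlim2.neg

/-- The bound by one on the whole space makes every point of K a maximum of χ, so the gradient of χ
vanishes on K itself and no neighbourhood on which χ = 1 is needed. -/
theorem exists_contDiff_cutoff {Ω K : Set (Euc n)} (hΩ : IsOpen Ω) (hK : IsCompact K)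
    (hKΩ : K ⊆ Ω) : ∃ χ : Euc n → ℝ, ContDiff ℝ ∞ χ ∧ HasCompactSupport χ ∧ tsupport χ ⊆ Ω ∧
      (∀ x, χ x ≤ 1) ∧ ∀ x ∈ K, χ x = 1 := by
  obtain ⟨K', hK', hKK', hK'Ω⟩ := exists_compact_between hK hΩ hKΩ
  obtain ⟨χ, hχ, hr, hsupp, h1⟩ := exists_contMDiff_support_eq_eq_one_iff
    (modelWithCornersSelf ℝ (Euc n)) isOpen_interior hK.isClosed hKK' (n := ⊤)
  have hts : tsupport χ ⊆ K' := by
    rw [tsupport, hsupp]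
    exact closure_minimal interior_subset hK'.isClosed
  exact ⟨χ, contMDiff_iff_contDiff.1 hχ, hK'.of_isClosed_subset (isClosed_tsupport χ) hts,
    hts.trans hK'Ω, fun x => (hr ⟨x, rfl⟩).2, fun x hx => (h1 x).1 hx⟩

theorem MeasureTheory.LocallyIntegrableOn.mono_of_restrict {E F : Type*} [NormedAddCommGroup E]
    [NormedAddCommGroup F] {Ω : Set (Euc n)} {f : Euc n → E} {g : Euc n → F}
    (hf : LocallyIntegrableOn f Ω volume) (hg : AEStronglyMeasurable g (volume.restrict Ω))
    (h : ∀ᵐ x, ‖g x‖ ≤ ‖f x‖) : LocallyIntegrableOn g Ω volume := by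
  intro x hx
  obtain ⟨s, hs, hfs⟩ := hf x hx
  exact ⟨s ∩ Ω, inter_mem hs self_mem_nhdsWithin,
    Integrable.mono (hfs.mono_set inter_subset_left) (hg.mono_set inter_subset_right)
      (ae_restrict_of_ae h)⟩

/-- The chain rule for the composition of a bounded `C¹` function with bounded derivative and a
weakly differentiable function. -/
theorem HasWeakGradientOn.comp {Ω : Set (Euc n)} (hΩ : IsOpen Ω) {v : Euc n → ℝ}
    {G : Euc n → Euc n} (h : HasWeakGradientOn Ω v G) {η : ℝ → ℝ} (hη : ContDiff ℝ 1 η) {B C : ℝ}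
    (hB : ∀ a, |η a| ≤ B) (hC : ∀ a, |deriv η a| ≤ C) :
    HasWeakGradientOn Ω (fun x => η (v x)) (fun x => deriv η (v x) • G x) := by
  have hdη : Continuous (deriv η) := hη.continuous_deriv le_rfl
  have hm : AEStronglyMeasurable v (volume.restrict Ω) := h.1.aestronglyMeasurable
  refine ⟨?_, ?_, fun φ hφ hφc hφΩ => ?_⟩
  · refine ((locallyIntegrable_const B).locallyIntegrableOn Ω).mono_of_restrict
      (hη.continuous.comp_aestronglyMeasurable hm) (ae_of_all _ fun x => ?_)
    exact (hB _).trans (le_abs_self B)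
  · have hi := h.2.1.smul C
    refine hi.mono_of_restrict ((hdη.comp_aestronglyMeasurable hm).smul h.2.1.aestronglyMeasurable)
      (ae_of_all _ fun x => ?_)
    simp only [norm_smul, Pi.smul_apply]
    gcongr
    exact (hC _).trans (le_abs_self C)
  -- Multiplying v by a cutoff equal to one on the support of φ gives a weakly differentiable
  -- function on the whole space with integrable gradient, to which the global chain rule applies.
  -- On the support of φ nothing has changed.
  · obtain ⟨χ, hχ, hχc, hχΩ, hχ1, hχK⟩ := exists_contDiff_cutoff hΩ hφc hφΩ
    have hgχ := hχ.continuous_gradient (by simp)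
    have iG : Integrable (fun x => χ x • G x + v x • gradient χ x) volume :=
      (h.2.1.integrable_smul_of_tsupport_subset hχ.continuous hχc hχΩ
        fun x hx => image_eq_zero_of_notMem_tsupport hx).add
      (h.1.integrable_smul_vector_of_tsupport_subset hgχ hχc hχΩ
        fun x hx => gradient_eq_zero_of_notMem_tsupport hx)
    have iv : Integrable (fun x => v x * χ x) volume := by
      simpa only [smul_eq_mul, mul_comm] using
        h.1.integrable_smul_of_tsupport_subset hχ.continuous hχc hχΩ
          fun x hx => image_eq_zero_of_notMem_tsupport hx
    have hW : HasWeakGradientOn univ (fun x => v x * χ x)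
        (fun x => χ x • G x + v x • gradient χ x) := by
      refine ⟨iv.locallyIntegrable.locallyIntegrableOn _,
        iG.locallyIntegrable.locallyIntegrableOn _, fun φ hφ hφc _ => ?_⟩
      have key := h.integral_mul_smul_gradient hχ hφ hφc (inter_subset_left.trans hχΩ)
      rw [setIntegral_eq_integral_of_forall_compl_eq_zero fun x hx => ?_,
        setIntegral_eq_integral_of_forall_compl_eq_zero fun x hx => ?_] at key
      · rw [setIntegral_univ, setIntegral_univ, key]
      · have hx' : x ∉ tsupport χ := fun h' => hx (hχΩ h')
        simp [image_eq_zero_of_notMem_tsupport hx', gradient_eq_zero_of_notMem_tsupport hx']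
      · have hx' : x ∉ tsupport χ := fun h' => hx (hχΩ h')
        simp [image_eq_zero_of_notMem_tsupport hx']
    have key := hW.integral_comp_smul_gradient iG hη hB hC hφ hφc
    rw [setIntegral_eq_integral_of_forall_compl_eq_zero fun x hx => ?_,
      setIntegral_eq_integral_of_forall_compl_eq_zero fun x hx => ?_]
    · refine Eq.trans ?_ (key.trans ?_)
      · congr 1
        ext1 x
        by_cases hx : x ∈ tsupport φ
        · simp [hχK x hx]
        · simp [gradient_eq_zero_of_notMem_tsupport hx]
      · congr 2
        ext1 x
        by_cases hx : x ∈ tsupport φ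
        · have hmax : IsLocalMax χ x := Eventually.of_forall fun y => (hχ1 y).trans (hχK x hx).ge
          have hg : gradient χ x = 0 := by simp [gradient, hmax.fderiv_eq_zero]
          simp [hχK x hx, hg]
        · simp [image_eq_zero_of_notMem_tsupport hx]
    · have hx' : x ∉ tsupport φ := fun h' => hx (hφΩ h')
      simp [image_eq_zero_of_notMem_tsupport hx']
    · have hx' : x ∉ tsupport φ := fun h' => hx (hφΩ h')
      simp [gradient_eq_zero_of_notMem_tsupport hx']

end ChainRule

/-! ### Gronwall's inequality for integrable functions -/

/-- Gronwall's inequality, backward in time and in integral form. -/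
theorem eq_zero_of_le_mul_integral_Ioo {y : ℝ → ℝ} {C T : ℝ} (hC : 0 ≤ C)
    (hy : IntegrableOn y (Ioo 0 T) volume) (h0 : ∀ a ∈ Ioo 0 T, 0 ≤ y a)
    (h : ∀ a ∈ Ioo 0 T, y a ≤ C * ∫ s in Ioo a T, y s) {a : ℝ} (ha : a ∈ Ioo 0 T) : y a = 0 := by
  set B := C * ∫ s in Ioo 0 T, y s with hB
  have hsub : ∀ {a : ℝ}, a ∈ Ioo 0 T → Ioo a T ⊆ Ioo 0 T := fun ha =>
    Ioo_subset_Ioo_left ha.1.le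
  -- Iterating the hypothesis k times produces the general term of an exponential series, which
  -- tends to zero. Integrability of y suffices; continuity is not used.
  have hk : ∀ k : ℕ, ∀ a ∈ Ioo 0 T, y a ≤ B * ((C * (T - a)) ^ k / (k.factorial : ℝ)) := by
    intro k
    induction k with
    | zero =>
      intro a ha
      simp only [pow_zero, Nat.factorial_zero, Nat.cast_one, div_one, mul_one]
      refine (h a ha).trans (mul_le_mul_of_nonneg_left ?_ hC)
      refine setIntegral_mono_set hy ?_ (LE.le.eventuallyLE (hsub ha))
      filter_upwards [ae_restrict_mem measurableSet_Ioo] with s hs using h0 s hs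
    | succ k ih =>
      intro a ha
      refine (h a ha).trans ?_
      have hcont : Continuous fun s : ℝ => B * ((C * (T - s)) ^ k / (k.factorial : ℝ)) := by
        fun_prop
      have h1 : ∫ s in Ioo a T, y s ≤
          ∫ s in Ioo a T, B * ((C * (T - s)) ^ k / (k.factorial : ℝ)) :=
        setIntegral_mono_on (hy.mono_set (hsub ha))
          (hcont.integrableOn_Icc.mono_set Ioo_subset_Icc_self) measurableSet_Ioo
          fun s hs => ih s (hsub ha hs)
      have h2 : ∫ s in Ioo a T, B * ((C * (T - s)) ^ k / (k.factorial : ℝ)) =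
          B * (C ^ k * ((T - a) ^ (k + 1) / (k + 1)) / (k.factorial : ℝ)) := by
        rw [← integral_Ioc_eq_integral_Ioo, ← intervalIntegral.integral_of_le ha.2.le,
          intervalIntegral.integral_const_mul, intervalIntegral.integral_div]
        simp_rw [mul_pow]
        rw [intervalIntegral.integral_const_mul,
          intervalIntegral.integral_comp_sub_left (fun s => s ^ k), integral_pow]
        simp
      refine (mul_le_mul_of_nonneg_left (h1.trans_eq h2) hC).trans_eq ?_
      rw [Nat.factorial_succ]
      push_cast
      have : (k.factorial : ℝ) ≠ 0 := by positivity
      have : (k : ℝ) + 1 ≠ 0 := by positivity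
      rw [mul_pow]
      field_simp
      ring
  have hlim := (FloorSemiring.tendsto_pow_div_factorial_atTop (C * (T - a))).const_mul B
  rw [mul_zero] at hlim
  exact le_antisymm (ge_of_tendsto' hlim fun k => hk k a ha) (h0 a ha)

/-! ### A C¹ truncation of the positive part and its convex primitive -/

/-- A bounded `C¹` approximation of the positive part, vanishing on the negative half line. -/
noncomputable def softRamp (d a : ℝ) : ℝ := max a 0 ^ 2 / (d + max a 0 + d * max a 0 ^ 2)

/-- The derivative of `softRamp d`. -/
noncomputable def softRampDeriv (d a : ℝ) : ℝ :=
  (2 * d * max a 0 + max a 0 ^ 2) / (d + max a 0 + d * max a 0 ^ 2) ^ 2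

/-- The primitive of `softRamp d` that vanishes at the origin. -/
noncomputable def softRampPrimitive (d a : ℝ) : ℝ := ∫ x in 0..a, softRamp d x

section SoftRamp

variable {d : ℝ}

theorem softRamp_denominator_pos (hd : 0 < d) (a : ℝ) : 0 < d + max a 0 + d * max a 0 ^ 2 := by
  have : 0 ≤ max a 0 := le_max_right _ _
  positivity

theorem softRamp_of_nonpos (d : ℝ) {a : ℝ} (ha : a ≤ 0) : softRamp d a = 0 := by
  simp [softRamp, max_eq_right ha]

theorem softRampDeriv_of_nonpos (d : ℝ) {a : ℝ} (ha : a ≤ 0) : softRampDeriv d a = 0 := by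
  simp [softRampDeriv, max_eq_right ha]

theorem softRamp_nonneg (hd : 0 < d) (a : ℝ) : 0 ≤ softRamp d a :=
  div_nonneg (sq_nonneg _) (softRamp_denominator_pos hd a).le

theorem softRampDeriv_nonneg (hd : 0 < d) (a : ℝ) : 0 ≤ softRampDeriv d a := by
  have : 0 ≤ max a 0 := le_max_right _ _
  unfold softRampDeriv
  positivity

/-- With p = max a 0, the numerator is (d + p)² - d², and (d + p)² is at most the denominator. -/
theorem softRampDeriv_le_one (hd : 0 < d) (a : ℝ) : softRampDeriv d a ≤ 1 := by
  have hp : 0 ≤ max a 0 := le_max_right _ _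
  have := softRamp_denominator_pos hd a
  rw [softRampDeriv, div_le_one (by positivity)]
  have h1 : (d + max a 0) ^ 2 ≤ (d + max a 0 + d * max a 0 ^ 2) ^ 2 :=
    pow_le_pow_left₀ (by positivity) (le_add_of_nonneg_right (by positivity)) 2
  nlinarith [sq_nonneg d]

theorem softRamp_le_max (hd : 0 < d) (a : ℝ) : softRamp d a ≤ max a 0 := by
  have hp : 0 ≤ max a 0 := le_max_right _ _
  rw [softRamp, div_le_iff₀ (softRamp_denominator_pos hd a)]
  have : 0 ≤ max a 0 * (d + d * max a 0 ^ 2) := by positivity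
  nlinarith

/-- The quadratic term of the denominator alone gives the bound. It is present so that the
truncation is an admissible bounded test function. -/
theorem softRamp_le_inv (hd : 0 < d) (a : ℝ) : softRamp d a ≤ d⁻¹ := by
  have hp : 0 ≤ max a 0 := le_max_right _ _
  rw [softRamp, div_le_iff₀ (softRamp_denominator_pos hd a), mul_add, ← mul_assoc,
    inv_mul_cancel₀ hd.ne']
  have : 0 ≤ d⁻¹ * (d + max a 0) := by positivity
  linarith

theorem continuous_softRamp (hd : 0 < d) : Continuous (softRamp d) :=
  Continuous.div (by fun_prop) (by fun_prop) fun a => (softRamp_denominator_pos hd a).ne'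

theorem continuous_softRampDeriv (hd : 0 < d) : Continuous (softRampDeriv d) :=
  Continuous.div (by fun_prop) (by fun_prop) fun a =>
    (pow_pos (softRamp_denominator_pos hd a) 2).ne'

theorem hasDerivAt_softRamp (hd : 0 < d) (a : ℝ) :
    HasDerivAt (softRamp d) (softRampDeriv d a) a := by
  have key : ∀ a ≠ 0, HasDerivAt (softRamp d) (softRampDeriv d a) a := by
    intro a ha
    rcases lt_or_gt_of_ne ha with h | h
    · rw [softRampDeriv_of_nonpos d h.le]
      refine (hasDerivAt_const a (0 : ℝ)).congr_of_eventuallyEq ?_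
      filter_upwards [gt_mem_nhds h] with x hx using softRamp_of_nonpos d hx.le
    · have hD : d + a + d * a ^ 2 ≠ 0 := by positivity
      have h1 : HasDerivAt (fun x : ℝ => x ^ 2 / (d + x + d * x ^ 2))
          ((2 * a * (d + a + d * a ^ 2) - a ^ 2 * (1 + d * (2 * a))) /
            (d + a + d * a ^ 2) ^ 2) a := by
        have hs : HasDerivAt (fun x : ℝ => x ^ 2) (2 * a) a := by
          simpa using hasDerivAt_pow 2 a
        exact hs.div (((hasDerivAt_id a).const_add d).add (hs.const_mul d)) hD
      have h2 : softRampDeriv d a = (2 * a * (d + a + d * a ^ 2) - a ^ 2 * (1 + d * (2 * a))) /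
            (d + a + d * a ^ 2) ^ 2 := by
        rw [softRampDeriv, max_eq_left h.le]
        ring
      rw [h2]
      refine h1.congr_of_eventuallyEq ?_
      filter_upwards [lt_mem_nhds h] with x hx
      rw [softRamp, max_eq_left (le_of_lt hx)]
  by_cases ha : a = 0
  -- At the origin the derivative is obtained as the limit of the derivatives at nearby points, both
  -- formulas being continuous there.
  · subst ha
    exact hasDerivAt_of_hasDerivAt_of_ne key (continuous_softRamp hd).continuousAt
      (continuous_softRampDeriv hd).continuousAt
  · exact key a ha

theorem deriv_softRamp (hd : 0 < d) : deriv (softRamp d) = softRampDeriv d :=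
  funext fun a => (hasDerivAt_softRamp hd a).deriv

theorem contDiff_softRamp (hd : 0 < d) : ContDiff ℝ 1 (softRamp d) := by
  rw [contDiff_one_iff_deriv, deriv_softRamp hd]
  exact ⟨fun a => (hasDerivAt_softRamp hd a).differentiableAt, continuous_softRampDeriv hd⟩

theorem monotone_softRamp (hd : 0 < d) : Monotone (softRamp d) :=
  monotone_of_deriv_nonneg (fun a => (hasDerivAt_softRamp hd a).differentiableAt) fun a => by
    rw [deriv_softRamp hd]
    exact softRampDeriv_nonneg hd a

theorem tendsto_softRamp (a : ℝ) :
    Tendsto (fun d => softRamp d a) (𝓝[>] 0) (𝓝 (max a 0)) := by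
  refine tendsto_nhdsWithin_of_tendsto_nhds ?_
  rcases le_or_gt a 0 with h | h
  · simp [softRamp_of_nonpos _ h, max_eq_right h]
  · have h1 : ContinuousAt (fun d => softRamp d a) 0 := by
      simp only [softRamp, max_eq_left h.le]
      refine ContinuousAt.div (by fun_prop) (by fun_prop) ?_
      simpa using h.ne'
    have h2 : softRamp 0 a = max a 0 := by
      simp only [softRamp, max_eq_left h.le]
      field_simp
      simp
    exact h2 ▸ h1.tendsto

theorem tendsto_softRampDeriv (a : ℝ) :
    Tendsto (fun d => softRampDeriv d a) (𝓝[>] 0) (𝓝 (if 0 < a then 1 else 0)) := by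
  refine tendsto_nhdsWithin_of_tendsto_nhds ?_
  rcases le_or_gt a 0 with h | h
  · simp [softRampDeriv_of_nonpos _ h, h.not_gt]
  · have h1 : ContinuousAt (fun d => softRampDeriv d a) 0 := by
      simp only [softRampDeriv, max_eq_left h.le]
      refine ContinuousAt.div (by fun_prop) (by fun_prop) ?_
      simpa using h.ne'
    have h2 : softRampDeriv 0 a = if 0 < a then 1 else 0 := by
      simp only [softRampDeriv, max_eq_left h.le, if_pos h]
      field_simp
      ring
    exact h2 ▸ h1.tendsto

theorem hasDerivAt_softRampPrimitive (hd : 0 < d) (a : ℝ) :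
    HasDerivAt (softRampPrimitive d) (softRamp d a) a :=
  intervalIntegral.integral_hasDerivAt_right ((continuous_softRamp hd).intervalIntegrable _ _)
    ((continuous_softRamp hd).stronglyMeasurableAtFilter _ _) (continuous_softRamp hd).continuousAt

theorem continuous_softRampPrimitive (hd : 0 < d) : Continuous (softRampPrimitive d) :=
  continuous_iff_continuousAt.2 fun a => (hasDerivAt_softRampPrimitive hd a).continuousAt

theorem softRampPrimitive_sub (hd : 0 < d) (a b : ℝ) :
    softRampPrimitive d a - softRampPrimitive d b = ∫ x in b..a, softRamp d x :=
  intervalIntegral.integral_interval_sub_left ((continuous_softRamp hd).intervalIntegrable _ _)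
    ((continuous_softRamp hd).intervalIntegrable _ _)

/-- The tangent inequality of a convex function: the integrand is monotone. It replaces the chain
rule in time. -/
theorem softRampPrimitive_sub_le (hd : 0 < d) (a b : ℝ) :
    softRampPrimitive d a - softRampPrimitive d b ≤ softRamp d a * (a - b) := by
  have hi : ∀ x y, IntervalIntegrable (softRamp d) volume x y := fun x y =>
    (continuous_softRamp hd).intervalIntegrable x y
  rw [softRampPrimitive_sub hd]
  rcases le_total b a with h | h
  · have := intervalIntegral.integral_mono_on h (hi b a)
      (intervalIntegrable_const (c := softRamp d a)) fun x hx => monotone_softRamp hd hx.2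
    rw [intervalIntegral.integral_const, smul_eq_mul] at this
    linarith
  · have := intervalIntegral.integral_mono_on h (intervalIntegrable_const (c := softRamp d a))
      (hi a b) fun x hx => monotone_softRamp hd hx.1
    rw [intervalIntegral.integral_const, smul_eq_mul] at this
    rw [intervalIntegral.integral_symm]
    linarith

theorem abs_softRampPrimitive_sub_le (hd : 0 < d) (a b : ℝ) :
    |softRampPrimitive d a - softRampPrimitive d b| ≤ d⁻¹ * |a - b| := by
  rw [softRampPrimitive_sub hd, ← Real.norm_eq_abs]
  refine intervalIntegral.norm_integral_le_of_norm_le_const fun x _ => ?_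
  rw [Real.norm_of_nonneg (softRamp_nonneg hd x)]
  exact softRamp_le_inv hd x

theorem softRampPrimitive_of_nonpos (d : ℝ) {a : ℝ} (ha : a ≤ 0) : softRampPrimitive d a = 0 := by
  rw [softRampPrimitive, intervalIntegral.integral_symm, neg_eq_zero]
  refine (intervalIntegral.integral_congr (g := fun _ => (0 : ℝ)) fun x hx => ?_).trans (by simp)
  rw [uIcc_of_le ha] at hx
  exact softRamp_of_nonpos d hx.2

theorem softRampPrimitive_nonneg (hd : 0 < d) (a : ℝ) : 0 ≤ softRampPrimitive d a := by
  rcases le_total a 0 with h | h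
  · rw [softRampPrimitive_of_nonpos d h]
  · exact intervalIntegral.integral_nonneg h fun x _ => softRamp_nonneg hd x

theorem integral_max_zero (a : ℝ) : ∫ x in (0 : ℝ)..a, max x 0 = max a 0 ^ 2 / 2 := by
  rcases le_total a 0 with h | h
  · rw [max_eq_right h, intervalIntegral.integral_symm,
      intervalIntegral.integral_congr (g := fun _ => (0 : ℝ)) fun x hx => ?_]
    · simp
    · rw [uIcc_of_le h] at hx
      exact max_eq_right hx.2
  · rw [max_eq_left h, intervalIntegral.integral_congr (g := fun x => x) fun x hx => ?_,
      integral_id]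
    · simp
    · rw [uIcc_of_le h] at hx
      exact max_eq_left hx.1

theorem softRampPrimitive_le (hd : 0 < d) (a : ℝ) :
    softRampPrimitive d a ≤ max a 0 ^ 2 / 2 := by
  rcases le_total a 0 with h | h
  · rw [softRampPrimitive_of_nonpos d h]
    positivity
  · rw [← integral_max_zero]
    exact intervalIntegral.integral_mono_on h ((continuous_softRamp hd).intervalIntegrable _ _)
      (Continuous.intervalIntegrable (by fun_prop) _ _) fun x _ => softRamp_le_max hd x

theorem tendsto_softRampPrimitive (a : ℝ) :
    Tendsto (fun d => softRampPrimitive d a) (𝓝[>] 0) (𝓝 (max a 0 ^ 2 / 2)) := by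
  rw [← integral_max_zero]
  refine intervalIntegral.tendsto_integral_filter_of_dominated_convergence (fun x => max x 0)
    ?_ ?_ (Continuous.intervalIntegrable (by fun_prop) _ _)
    (ae_of_all _ fun x _ => tendsto_softRamp x)
  · filter_upwards [self_mem_nhdsWithin] with d hd
    exact (continuous_softRamp hd).aestronglyMeasurable
  · filter_upwards [self_mem_nhdsWithin] with d hd
    refine ae_of_all _ fun x _ => ?_
    rw [Real.norm_of_nonneg (softRamp_nonneg hd x)]
    exact softRamp_le_max hd x

end SoftRamp

/-! ### Truncated test functions and their energy increments -/

theorem spaceTimeMeasure_eq_restrict {X : Type*} [MeasurableSpace X] (μ : Measure X) [SFinite μ]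
    (a b : ℝ) :
    spaceTimeMeasure μ a b = (volume.prod μ).restrict (Ioo a b ×ˢ univ) := by
  rw [spaceTimeMeasure, ← Measure.prod_restrict, Measure.restrict_univ]

theorem spaceTimeMeasure_mono {X : Type*} [MeasurableSpace X] (μ : Measure X) [SFinite μ]
    {a b c d : ℝ} (h₁ : c ≤ a) (h₂ : b ≤ d) : spaceTimeMeasure μ a b ≤ spaceTimeMeasure μ c d := by
  rw [spaceTimeMeasure_eq_restrict, spaceTimeMeasure_eq_restrict]
  exact Measure.restrict_mono (prod_mono_left (Ioo_subset_Ioo h₁ h₂)) le_rfl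

section Comparison

variable {n : ℕ} {X : Type*} [PseudoMetricSpace X] [MeasurableSpace X]

/-- A spatial cutoff with bounded support and gradient bounded by `δ`, compatible with the weak
gradient through the product and chain rules. -/
structure IsSpatialCutoff (WG : (X → ℝ) → (X → Euc n) → Prop) (δ : ℝ) (ζ : X → ℝ)
    (Dζ : X → Euc n) : Prop where
  measurable : Measurable ζ
  measurable_grad : Measurable Dζ
  nonneg : ∀ x, 0 ≤ ζ x
  le_one : ∀ x, ζ x ≤ 1
  grad_le : ∀ x, ‖Dζ x‖ ≤ δ
  bounded_support : Bornology.IsBounded (Function.support ζ)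
  comp_mul : ∀ (v : X → ℝ) (G : X → Euc n) (η : ℝ → ℝ) (B C : ℝ), WG v G → ContDiff ℝ 1 η →
    (∀ a, |η a| ≤ B) → (∀ a, |deriv η a| ≤ C) →
    WG (fun x => η (v x) * ζ x) (fun x => (deriv η (v x) * ζ x) • G x + η (v x) • Dζ x)

/-- `w - k` is an energy subsolution of `-∂ₜv - ε Δv + h = 0` with `v(T) ≤ 0`, where `k` depends
on time only and `A` is the spatial gradient of `w`. -/
structure IsEnergySubsolution (μ : Measure X) (WG : (X → ℝ) → (X → Euc n) → Prop) (ε T : ℝ)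
    (h : ℝ → X → ℝ) (k : ℝ → ℝ) (w : ℝ → X → ℝ) (A : ℝ → X → Euc n) : Prop where
  slice_memLp : ∀ t ∈ Icc 0 T, MemLp (w t) 2 μ
  continuous_in_time : ∀ t ∈ Icc 0 T,
    Tendsto (fun s => eLpNorm (w s - w t) 2 μ) (𝓝[Icc 0 T] t) (𝓝 0)
  memLp : MemLp (fun z : ℝ × X => w z.1 z.2) 2 (spaceTimeMeasure μ 0 T)
  grad_memLp : MemLp (fun z : ℝ × X => A z.1 z.2) 2 (spaceTimeMeasure μ 0 T)
  drift_memLp : MemLp (fun z : ℝ × X => h z.1 z.2) 2 (spaceTimeMeasure μ 0 T)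
  weak_grad : ∀ᵐ t ∂(volume.restrict (Ioo 0 T)), WG (w t) (A t)
  continuous_level : Continuous k
  level_nonneg : ∀ t, 0 ≤ k t
  terminal : ∀ᵐ x ∂μ, w T x ≤ k T
  increment : ∀ ψ Dψ, IsTestFunction μ WG ψ Dψ → (∀ x, 0 ≤ ψ x) → ∀ s ∈ Icc 0 T, ∀ t ∈ Icc s T,
    ∫ x, (w s x - w t x) * ψ x ∂μ ≤ (k s - k t) * ∫ x, ψ x ∂μ -
      ∫ z, (ε * inner ℝ (A z.1 z.2) (Dψ z.2) + h z.1 z.2 * ψ z.2) ∂(spaceTimeMeasure μ s t)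

/-- The truncation used as a test function. -/
noncomputable def truncatedTest (d : ℝ) (k : ℝ → ℝ) (ζ : X → ℝ) (w : ℝ → X → ℝ) (z : ℝ × X) : ℝ :=
  softRamp d (w z.1 z.2 - k z.1) * ζ z.2

/-- The weak gradient of the truncation used as a test function. -/
noncomputable def truncatedTestGrad (d : ℝ) (k : ℝ → ℝ) (ζ : X → ℝ) (Dζ : X → Euc n)
    (w : ℝ → X → ℝ) (A : ℝ → X → Euc n) (z : ℝ × X) : Euc n :=
  (softRampDeriv d (w z.1 z.2 - k z.1) * ζ z.2) • A z.1 z.2 +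
    softRamp d (w z.1 z.2 - k z.1) • Dζ z.2

/-- The localized energy of the truncation. -/
noncomputable def truncatedEnergy (μ : Measure X) (d : ℝ) (k : ℝ → ℝ) (ζ : X → ℝ)
    (w : ℝ → X → ℝ) (t : ℝ) : ℝ :=
  ∫ x, softRampPrimitive d (w t x - k t) * ζ x ∂μ

theorem max_sub_zero_le_abs {a k : ℝ} (hk : 0 ≤ k) : max (a - k) 0 ≤ |a| :=
  max_le (by linarith [le_abs_self a]) (abs_nonneg a)

theorem softRamp_sub_le_abs {d a k : ℝ} (hd : 0 < d) (hk : 0 ≤ k) :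
    softRamp d (a - k) ≤ |a| := (softRamp_le_max hd _).trans (max_sub_zero_le_abs hk)

theorem softRampPrimitive_sub_le_sq {d a k : ℝ} (hd : 0 < d) (hk : 0 ≤ k) :
    softRampPrimitive d (a - k) ≤ a ^ 2 := by
  have h1 := softRampPrimitive_le hd (a - k)
  have h2 := max_sub_zero_le_abs (a := a) hk
  have h3 : (0 : ℝ) ≤ max (a - k) 0 := le_max_right _ _
  have h4 := pow_le_pow_left₀ h3 h2 2
  rw [sq_abs] at h4
  nlinarith [sq_nonneg a]

namespace IsEnergySubsolution

variable {μ : Measure X} {WG : (X → ℝ) → (X → Euc n) → Prop} {ε T δ d : ℝ}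
  {h : ℝ → X → ℝ} {k : ℝ → ℝ} {w : ℝ → X → ℝ} {A : ℝ → X → Euc n} {ζ : X → ℝ} {Dζ : X → Euc n}

theorem aestronglyMeasurable_sub_level (H : IsEnergySubsolution μ WG ε T h k w A) :
    AEStronglyMeasurable (fun z : ℝ × X => w z.1 z.2 - k z.1) (spaceTimeMeasure μ 0 T) :=
  H.memLp.1.sub (H.continuous_level.measurable.comp measurable_fst).aestronglyMeasurable

theorem memLp_truncatedTest (H : IsEnergySubsolution μ WG ε T h k w A)
    (hζ : IsSpatialCutoff WG δ ζ Dζ) (hd : 0 < d) :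
    MemLp (truncatedTest d k ζ w) 2 (spaceTimeMeasure μ 0 T) := by
  refine H.memLp.of_le (((continuous_softRamp hd).comp_aestronglyMeasurable
    H.aestronglyMeasurable_sub_level).mul
    (hζ.measurable.comp measurable_snd).aestronglyMeasurable) (ae_of_all _ fun z => ?_)
  rw [truncatedTest, norm_mul, Real.norm_of_nonneg (softRamp_nonneg hd _),
    Real.norm_of_nonneg (hζ.nonneg _), Real.norm_eq_abs]
  exact (mul_le_of_le_one_right (softRamp_nonneg hd _) (hζ.le_one _)).trans
    (softRamp_sub_le_abs hd (H.level_nonneg _))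

/-- The slope of the ramp lies in [0, 1] and the ramp is at most |w| because the level is
nonnegative. The bound does not depend on d, so it serves again as a dominating function when d → 0.
-/
theorem norm_truncatedTestGrad_le (hζ : IsSpatialCutoff WG δ ζ Dζ) (hd : 0 < d) (z : ℝ × X)
    (hk : 0 ≤ k z.1) :
    ‖truncatedTestGrad d k ζ Dζ w A z‖ ≤ ‖A z.1 z.2‖ + δ * |w z.1 z.2| := by
  refine (norm_add_le _ _).trans (add_le_add ?_ ?_)
  · rw [norm_smul, norm_mul, Real.norm_of_nonneg (softRampDeriv_nonneg hd _),
      Real.norm_of_nonneg (hζ.nonneg _)]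
    exact mul_le_of_le_one_left (norm_nonneg _)
      (mul_le_one₀ (softRampDeriv_le_one hd _) (hζ.nonneg _) (hζ.le_one _))
  · rw [norm_smul, Real.norm_of_nonneg (softRamp_nonneg hd _), mul_comm]
    exact mul_le_mul (hζ.grad_le _) (softRamp_sub_le_abs hd hk) (softRamp_nonneg hd _)
      ((norm_nonneg _).trans (hζ.grad_le z.2))

theorem memLp_truncatedTestGrad (H : IsEnergySubsolution μ WG ε T h k w A)
    (hζ : IsSpatialCutoff WG δ ζ Dζ) (hd : 0 < d) :
    MemLp (truncatedTestGrad d k ζ Dζ w A) 2 (spaceTimeMeasure μ 0 T) := by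
  have hm := H.aestronglyMeasurable_sub_level
  have h1 : MemLp (fun z : ℝ × X => ‖A z.1 z.2‖ + δ * |w z.1 z.2|) 2 (spaceTimeMeasure μ 0 T) :=
    H.grad_memLp.norm.add (H.memLp.norm.const_mul δ)
  refine h1.of_le ?_ (ae_of_all _ fun z =>
    (norm_truncatedTestGrad_le hζ hd z (H.level_nonneg _)).trans (le_abs_self _))
  exact ((((continuous_softRampDeriv hd).comp_aestronglyMeasurable hm).mul
    (hζ.measurable.comp measurable_snd).aestronglyMeasurable).smul H.grad_memLp.1).add
    (((continuous_softRamp hd).comp_aestronglyMeasurable hm).smul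
      (hζ.measurable_grad.comp measurable_snd).aestronglyMeasurable)

theorem isTestFunction_truncatedTest (H : IsEnergySubsolution μ WG ε T h k w A)
    (hζ : IsSpatialCutoff WG δ ζ Dζ) (hd : 0 < d) {s : ℝ} (hs : s ∈ Icc 0 T)
    (hA : MemLp (A s) 2 μ) (hWG : WG (w s) (A s)) :
    IsTestFunction μ WG (fun x => truncatedTest d k ζ w (s, x))
      (fun x => truncatedTestGrad d k ζ Dζ w A (s, x)) := by
  have hw := H.slice_memLp s hs
  have hm : AEStronglyMeasurable (fun x => w s x - k s) μ := hw.1.sub aestronglyMeasurable_const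
  have hΨm : AEStronglyMeasurable (fun x => truncatedTest d k ζ w (s, x)) μ :=
    ((continuous_softRamp hd).comp_aestronglyMeasurable hm).mul hζ.measurable.aestronglyMeasurable
  have hΨ0 : ∀ x, ‖truncatedTest d k ζ w (s, x)‖ ≤ softRamp d (w s x - k s) := fun x => by
    rw [truncatedTest, norm_mul, Real.norm_of_nonneg (softRamp_nonneg hd _),
      Real.norm_of_nonneg (hζ.nonneg _)]
    exact mul_le_of_le_one_right (softRamp_nonneg hd _) (hζ.le_one _)
  refine ⟨?_, ?_, ?_, ?_, ?_⟩
  · exact hw.of_le hΨm (ae_of_all _ fun x =>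
      (hΨ0 x).trans (softRamp_sub_le_abs hd (H.level_nonneg _)))
  · exact memLp_top_of_bound hΨm d⁻¹ (ae_of_all _ fun x =>
      (hΨ0 x).trans (softRamp_le_inv hd _))
  · refine hζ.bounded_support.subset fun x hx hx0 => hx ?_
    simp [truncatedTest, hx0]
  · have h1 : MemLp (fun x => ‖A s x‖ + δ * |w s x|) 2 μ := hA.norm.add (hw.norm.const_mul δ)
    refine h1.of_le ?_ (ae_of_all _ fun x =>
      (norm_truncatedTestGrad_le hζ hd (s, x) (H.level_nonneg _)).trans (le_abs_self _))
    exact ((((continuous_softRampDeriv hd).comp_aestronglyMeasurable hm).mul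
      hζ.measurable.aestronglyMeasurable).smul hA.1).add
      (((continuous_softRamp hd).comp_aestronglyMeasurable hm).smul
        hζ.measurable_grad.aestronglyMeasurable)
  -- For frozen time the level is a constant, so the chain rule is applied to the ramp shifted by k
  -- s.
  · have hder : ∀ a, deriv (fun a => softRamp d (a - k s)) a = softRampDeriv d (a - k s) :=
      fun a => by rw [deriv_comp_sub_const, deriv_softRamp hd]
    have := hζ.comp_mul (w s) (A s) (fun a => softRamp d (a - k s)) d⁻¹ 1 hWG
      ((contDiff_softRamp hd).comp (contDiff_id.sub contDiff_const))
      (fun a => by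
        rw [abs_of_nonneg (softRamp_nonneg hd _)]
        exact softRamp_le_inv hd _)
      (fun a => by
        rw [hder, abs_of_nonneg (softRampDeriv_nonneg hd _)]
        exact softRampDeriv_le_one hd _)
    simp only [hder] at this
    exact this

theorem integrable_truncatedEnergy (H : IsEnergySubsolution μ WG ε T h k w A)
    (hζ : IsSpatialCutoff WG δ ζ Dζ) (hd : 0 < d) {t : ℝ} (ht : t ∈ Icc 0 T) :
    Integrable (fun x => softRampPrimitive d (w t x - k t) * ζ x) μ := by
  have hw := H.slice_memLp t ht
  refine hw.integrable_sq.mono' (((continuous_softRampPrimitive hd).comp_aestronglyMeasurable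
    (hw.1.sub aestronglyMeasurable_const)).mul hζ.measurable.aestronglyMeasurable)
    (ae_of_all _ fun x => ?_)
  rw [norm_mul, Real.norm_of_nonneg (softRampPrimitive_nonneg hd _),
    Real.norm_of_nonneg (hζ.nonneg _)]
  exact (mul_le_of_le_one_right (softRampPrimitive_nonneg hd _) (hζ.le_one _)).trans
    (softRampPrimitive_sub_le_sq hd (H.level_nonneg t))

variable [ProperSpace X] [BorelSpace X] [IsLocallyFiniteMeasure μ]

theorem _root_.IsSpatialCutoff.memLp (hζ : IsSpatialCutoff WG δ ζ Dζ) (p : ℝ≥0∞) :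
    MemLp ζ p μ := by
  have hb := hζ.bounded_support.measure_lt_top (μ := μ)
  have hms : MeasurableSet (Function.support ζ) := measurableSet_support hζ.measurable
  have hfin : IsFiniteMeasure (μ.restrict (Function.support ζ)) := ⟨by simpa using hb⟩
  have h1 : MemLp ζ p (μ.restrict (Function.support ζ)) :=
    MemLp.of_bound hζ.measurable.aestronglyMeasurable 1 (ae_of_all _ fun x => by
      rw [Real.norm_of_nonneg (hζ.nonneg x)]
      exact hζ.le_one x)
  rw [← memLp_indicator_iff_restrict hms] at h1
  simpa [Set.indicator_support] using h1

/-- The primitive is Lipschitz with constant 1/d, so continuity of w in L² transfers by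
Cauchy–Schwarz against ζ, which has finite mass and finite L² norm. -/
theorem continuousOn_truncatedEnergy (H : IsEnergySubsolution μ WG ε T h k w A)
    (hζ : IsSpatialCutoff WG δ ζ Dζ) (hd : 0 < d) :
    ContinuousOn (truncatedEnergy μ d k ζ w) (Icc 0 T) := by
  intro t ht
  have hζ1 : Integrable ζ μ := memLp_one_iff_integrable.1 (hζ.memLp 1)
  have hζ2 : MemLp ζ 2 μ := hζ.memLp 2
  have hbound : ∀ s ∈ Icc 0 T, ‖truncatedEnergy μ d k ζ w s - truncatedEnergy μ d k ζ w t‖ ≤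
      d⁻¹ * ((eLpNorm (w s - w t) 2 μ).toReal * (eLpNorm ζ 2 μ).toReal +
        |k s - k t| * ∫ x, ζ x ∂μ) := by
    intro s hs
    have hwst := (H.slice_memLp s hs).sub (H.slice_memLp t ht)
    have i1 : Integrable (fun x => ‖(w s - w t) x‖ * ‖ζ x‖) μ :=
      hwst.norm.integrable_mul hζ2.norm
    have i2 : Integrable (fun x => |k s - k t| * ζ x) μ := hζ1.const_mul _
    have hCS : ∫ x, ‖(w s - w t) x‖ * ‖ζ x‖ ∂μ ≤
        (eLpNorm (w s - w t) 2 μ).toReal * (eLpNorm ζ 2 μ).toReal := by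
      have := integral_mul_norm_le_Lp_mul_Lq (Real.HolderConjugate.two_two) (f := w s - w t)
        (g := ζ) (μ := μ) (by simpa using hwst) (by simpa using hζ2)
      rw [hwst.eLpNorm_eq_integral_rpow_norm two_ne_zero ENNReal.ofNat_ne_top,
        hζ2.eLpNorm_eq_integral_rpow_norm two_ne_zero ENNReal.ofNat_ne_top,
        ENNReal.toReal_ofReal (by positivity), ENNReal.toReal_ofReal (by positivity)]
      simpa [Real.norm_eq_abs] using this
    rw [truncatedEnergy, truncatedEnergy, ← integral_sub (H.integrable_truncatedEnergy hζ hd hs)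
      (H.integrable_truncatedEnergy hζ hd ht)]
    calc ‖∫ x, (softRampPrimitive d (w s x - k s) * ζ x -
          softRampPrimitive d (w t x - k t) * ζ x) ∂μ‖
        ≤ ∫ x, d⁻¹ * (‖(w s - w t) x‖ * ‖ζ x‖ + |k s - k t| * ζ x) ∂μ := by
          refine norm_integral_le_of_norm_le ((i1.add i2).const_mul _) (ae_of_all _ fun x => ?_)
          rw [← sub_mul, norm_mul, Real.norm_eq_abs, Real.norm_of_nonneg (hζ.nonneg x),
            ← add_mul, ← mul_assoc]
          refine mul_le_mul_of_nonneg_right ((abs_softRampPrimitive_sub_le hd _ _).trans ?_)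
            (hζ.nonneg x)
          refine mul_le_mul_of_nonneg_left ?_ (inv_nonneg.2 hd.le)
          have : w s x - k s - (w t x - k t) = (w s x - w t x) - (k s - k t) := by ring
          rw [this]
          exact abs_sub _ _
      _ ≤ _ := by
          rw [integral_const_mul, integral_add i1 i2, integral_const_mul]
          exact mul_le_mul_of_nonneg_left (add_le_add_left hCS _) (inv_nonneg.2 hd.le)
  have h1 : Tendsto (fun s => (eLpNorm (w s - w t) 2 μ).toReal) (𝓝[Icc 0 T] t) (𝓝 0) := by
    have := (ENNReal.tendsto_toReal ENNReal.zero_ne_top).comp (H.continuous_in_time t ht)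
    rwa [ENNReal.toReal_zero] at this
  have h2 : Tendsto (fun s => |k s - k t|) (𝓝[Icc 0 T] t) (𝓝 0) := by
    have : ContinuousAt (fun s => |k s - k t|) t :=
      (H.continuous_level.sub continuous_const).abs.continuousAt
    simpa [ContinuousAt] using this.tendsto.mono_left nhdsWithin_le_nhds
  have h3 := ((h1.mul_const (eLpNorm ζ 2 μ).toReal).add
    (h2.mul_const (∫ x, ζ x ∂μ))).const_mul d⁻¹
  simp only [zero_mul, add_zero, mul_zero] at h3
  refine tendsto_iff_norm_sub_tendsto_zero.2 (squeeze_zero' (Eventually.of_forall fun _ =>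
    norm_nonneg _) ?_ h3)
  filter_upwards [self_mem_nhdsWithin] with s hs using hbound s hs

/-- Convexity puts the slope at the earlier time s, and that slope times ζ is exactly the stationary
test function allowed in the increment inequality. The terms with k cancel. -/
theorem truncatedEnergy_sub_le (H : IsEnergySubsolution μ WG ε T h k w A)
    (hζ : IsSpatialCutoff WG δ ζ Dζ) (hd : 0 < d) {s : ℝ} (hs : s ∈ Icc 0 T)
    (hA : MemLp (A s) 2 μ) (hWG : WG (w s) (A s)) {t : ℝ} (ht : t ∈ Icc s T) :
    truncatedEnergy μ d k ζ w s - truncatedEnergy μ d k ζ w t ≤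
      -∫ z, (ε * inner ℝ (A z.1 z.2) (truncatedTestGrad d k ζ Dζ w A (s, z.2)) +
        h z.1 z.2 * truncatedTest d k ζ w (s, z.2)) ∂(spaceTimeMeasure μ s t) := by
  have ht' : t ∈ Icc 0 T := ⟨hs.1.trans ht.1, ht.2⟩
  have hT := H.isTestFunction_truncatedTest hζ hd hs hA hWG
  have hΨ0 : ∀ x, 0 ≤ truncatedTest d k ζ w (s, x) := fun x =>
    mul_nonneg (softRamp_nonneg hd _) (hζ.nonneg _)
  have hinc := H.increment _ _ hT hΨ0 s hs t ht
  have iΨ : Integrable (fun x => truncatedTest d k ζ w (s, x)) μ := by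
    have hζ1 : Integrable ζ μ := memLp_one_iff_integrable.1 (hζ.memLp 1)
    refine (hζ1.const_mul d⁻¹).mono' hT.memLp_two.1 (ae_of_all _ fun x => ?_)
    rw [Real.norm_of_nonneg (hΨ0 x)]
    exact mul_le_mul_of_nonneg_right (softRamp_le_inv hd _) (hζ.nonneg x)
  have iw : Integrable (fun x => (w s x - w t x) * truncatedTest d k ζ w (s, x)) μ :=
    ((H.slice_memLp s hs).sub (H.slice_memLp t ht')).integrable_mul hT.memLp_two
  have hconv : truncatedEnergy μ d k ζ w s - truncatedEnergy μ d k ζ w t ≤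
      ∫ x, ((w s x - w t x) * truncatedTest d k ζ w (s, x) -
        (k s - k t) * truncatedTest d k ζ w (s, x)) ∂μ := by
    rw [truncatedEnergy, truncatedEnergy, ← integral_sub (H.integrable_truncatedEnergy hζ hd hs)
      (H.integrable_truncatedEnergy hζ hd ht')]
    refine integral_mono ((H.integrable_truncatedEnergy hζ hd hs).sub
      (H.integrable_truncatedEnergy hζ hd ht')) (iw.sub (iΨ.const_mul _)) fun x => ?_
    have := mul_le_mul_of_nonneg_right
      (softRampPrimitive_sub_le hd (w s x - k s) (w t x - k t)) (hζ.nonneg x)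
    simp only [truncatedTest]
    linarith
  rw [integral_sub iw (iΨ.const_mul _), integral_const_mul] at hconv
  linarith

end IsEnergySubsolution

end Comparison

/-! ### The energy estimate and the weak maximum principle -/

theorem ae_memLp_slice {X E : Type*} [MeasurableSpace X] {μ : Measure X} {T : ℝ}
    [NormedAddCommGroup E] [SFinite μ] {f : ℝ → X → E}
    (hf : MemLp (fun z : ℝ × X => f z.1 z.2) 2 (spaceTimeMeasure μ 0 T)) :
    ∀ᵐ t ∂(volume.restrict (Ioo 0 T)), MemLp (f t) 2 μ := by
  have h1 := hf.norm.integrable_sq.prod_right_ae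
  filter_upwards [h1, hf.1.prodMk_left] with t h1 h2
  rw [← memLp_norm_iff h2, memLp_two_iff_integrable_sq h2.norm]
  exact h1

/-- Young's inequality by completing the square (2ε|p| - Mv)²/(4ε) ≥ 0, on the set where v is
positive. -/
theorem neg_energy_density_le {n : ℕ} {ε M b v : ℝ} {p : Euc n} (hε : 0 < ε)
    (hb : |b| ≤ M * ‖p‖) :
    -(ε * inner ℝ p ((if 0 < v then (1 : ℝ) else 0) • p) + b * max v 0) ≤
      M ^ 2 / (4 * ε) * max v 0 ^ 2 := by
  rcases le_or_gt v 0 with hv | hv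
  · simp [hv.not_gt, max_eq_right hv]
  · rw [if_pos hv, one_smul, real_inner_self_eq_norm_sq, max_eq_left hv.le]
    have h1 : -(b * v) ≤ M * ‖p‖ * v := by
      rw [← neg_mul]
      exact mul_le_mul_of_nonneg_right ((neg_le_abs b).trans hb) hv.le
    have h2 : 0 ≤ (2 * ε * ‖p‖ - M * v) ^ 2 / (4 * ε) := by positivity
    have h3 : (2 * ε * ‖p‖ - M * v) ^ 2 / (4 * ε) =
        ε * ‖p‖ ^ 2 - M * ‖p‖ * v + M ^ 2 / (4 * ε) * v ^ 2 := by
      field_simp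
      ring
    linarith

section Comparison

variable {n : ℕ} {X : Type*} [PseudoMetricSpace X] [MeasurableSpace X]

namespace IsEnergySubsolution

variable {μ : Measure X} {WG : (X → ℝ) → (X → Euc n) → Prop} {ε T δ d : ℝ}
  {h : ℝ → X → ℝ} {k : ℝ → ℝ} {w : ℝ → X → ℝ} {A : ℝ → X → Euc n} {ζ : X → ℝ} {Dζ : X → Euc n}

theorem truncatedEnergy_terminal (H : IsEnergySubsolution μ WG ε T h k w A) :
    truncatedEnergy μ d k ζ w T = 0 := by
  rw [truncatedEnergy]
  refine integral_eq_zero_of_ae ?_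
  filter_upwards [H.terminal] with x hx
  simp [softRampPrimitive_of_nonpos d (sub_nonpos.2 hx)]

theorem integrable_posPart_sq (H : IsEnergySubsolution μ WG ε T h k w A) :
    Integrable (fun z : ℝ × X => max (w z.1 z.2 - k z.1) 0 ^ 2) (spaceTimeMeasure μ 0 T) := by
  refine H.memLp.integrable_sq.mono' ?_ (ae_of_all _ fun z => ?_)
  · exact (Continuous.comp_aestronglyMeasurable (g := fun a : ℝ => max a 0 ^ 2) (by fun_prop)
      H.aestronglyMeasurable_sub_level)
  · rw [Real.norm_of_nonneg (sq_nonneg _), ← sq_abs (w z.1 z.2)]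
    exact pow_le_pow_left₀ (le_max_right _ _) (max_sub_zero_le_abs (H.level_nonneg _)) 2

variable [ProperSpace X] [BorelSpace X] [IsLocallyFiniteMeasure μ]

/-- The energy estimate for the truncations, in integrated form. -/
theorem truncatedEnergy_le (H : IsEnergySubsolution μ WG ε T h k w A)
    (hζ : IsSpatialCutoff WG δ ζ Dζ) (hd : 0 < d) {a : ℝ} (ha : a ∈ Ioo 0 T) :
    truncatedEnergy μ d k ζ w a ≤
      ∫ z, -(ε * inner ℝ (A z.1 z.2) (truncatedTestGrad d k ζ Dζ w A z) +
        h z.1 z.2 * truncatedTest d k ζ w z) ∂(spaceTimeMeasure μ a T) := by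
  have hT0 : 0 ≤ T := ha.1.le.trans ha.2.le
  set S : Set (ℝ × X) := Ioo 0 T ×ˢ univ with hS
  have hSm : MeasurableSet S := measurableSet_Ioo.prod MeasurableSet.univ
  have hle : spaceTimeMeasure μ a T ≤ spaceTimeMeasure μ 0 T :=
    spaceTimeMeasure_mono μ ha.1.le le_rfl
  have hV := H.memLp_truncatedTestGrad hζ hd
  have hΨ := H.memLp_truncatedTest hζ hd
  have hP0 : MemLp (fun z : ℝ × X => -(ε • A z.1 z.2)) 2 (spaceTimeMeasure μ 0 T) :=
    (H.grad_memLp.const_smul ε).neg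
  have hP0' : MemLp (fun z : ℝ × X => -h z.1 z.2) 2 (spaceTimeMeasure μ 0 T) :=
    H.drift_memLp.neg
  have hP := (memLp_indicator_iff_restrict hSm).2 (spaceTimeMeasure_eq_restrict μ 0 T ▸ hP0)
  have hP' := (memLp_indicator_iff_restrict hSm).2 (spaceTimeMeasure_eq_restrict μ 0 T ▸ hP0')
  -- The limit argument looks at s + δ for every δ > 0, possibly beyond T. The energy is therefore
  -- continued as a constant, and correspondingly the equation's factors are extended by zero.
  set Y : ℝ → ℝ := IccExtend hT0 ((Icc 0 T).domRestrict (truncatedEnergy μ d k ζ w)) with hY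
  have hYc : Continuous Y :=
    (continuousOn_iff_continuous_domRestrict.1 (H.continuousOn_truncatedEnergy hζ hd)).Icc_extend'
  have hYin : ∀ t ∈ Icc 0 T, Y t = truncatedEnergy μ d k ζ w t := fun t ht => by
    rw [hY, IccExtend_of_mem hT0 _ ht, domRestrict_apply]
  have hYout : ∀ t, T ≤ t → Y t = truncatedEnergy μ d k ζ w T := fun t ht => by
    rw [hY, IccExtend_of_right_le hT0 _ ht, domRestrict_apply]
  have hYmin : ∀ t, 0 ≤ t → Y t = truncatedEnergy μ d k ζ w (min t T) := fun t ht => by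
    rcases le_total t T with h | h
    · rw [hYin t ⟨ht, h⟩, min_eq_left h]
    · rw [hYout t h, min_eq_right h]
  have hind : ∀ {F : ℝ × X → ℝ} {s t : ℝ}, 0 ≤ s →
      ∫ z, S.indicator F z ∂(spaceTimeMeasure μ s t) =
        ∫ z, F z ∂(spaceTimeMeasure μ s (min t T)) := by
    intro F s t hs
    rw [integral_indicator hSm, spaceTimeMeasure_eq_restrict, spaceTimeMeasure_eq_restrict,
      Measure.restrict_restrict hSm, hS, prod_inter_prod, Ioo_inter_Ioo, univ_inter]
    simp only [sup_of_le_right hs, inf_comm T t]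
  -- The moving factors are -εA and -h; the frozen ones are the gradient and the value of the test
  -- function.
  have key := sub_le_integral_inner_of_increments ha.2.le hP (hV.mono_measure hle) hP'
    (hΨ.mono_measure hle) hYc ?_
  · rw [hYin a ⟨ha.1.le, ha.2.le⟩, hYin T ⟨hT0, le_rfl⟩, H.truncatedEnergy_terminal,
      sub_zero] at key
    refine key.trans_eq ?_
    have e1 : ∀ z, inner ℝ (truncatedTestGrad d k ζ Dζ w A z)
        (S.indicator (fun z : ℝ × X => -(ε • A z.1 z.2)) z) =
        S.indicator (fun z : ℝ × X => inner ℝ (truncatedTestGrad d k ζ Dζ w A z)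
          (-(ε • A z.1 z.2))) z := fun z => by
      by_cases hz : z ∈ S <;> simp [hz]
    have e2 : ∀ z, inner ℝ (truncatedTest d k ζ w z)
        (S.indicator (fun z : ℝ × X => -h z.1 z.2) z) =
        S.indicator (fun z : ℝ × X => inner ℝ (truncatedTest d k ζ w z) (-h z.1 z.2)) z :=
      fun z => by
      by_cases hz : z ∈ S <;> simp [hz]
    simp_rw [e1, e2]
    rw [hind ha.1.le, hind ha.1.le, min_self, ← integral_add
      ((hV.mono_measure hle).integrable_inner_real (hP0.mono_measure hle))
      ((hΨ.mono_measure hle).integrable_inner_real (hP0'.mono_measure hle))]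
    refine integral_congr_ae (ae_of_all _ fun z => ?_)
    simp only [inner_neg_right, inner_smul_right, real_inner_comm (A z.1 z.2)]
    simp
    ring
  · have hres : ∀ {p : ℝ → Prop}, (∀ᵐ s ∂(volume.restrict (Ioo 0 T)), p s) →
        ∀ᵐ s ∂(volume.restrict (Ioo a T)), p s := fun hp =>
      ae_restrict_of_ae_restrict_of_subset (Ioo_subset_Ioo_left ha.1.le) hp
    -- The slice of w at time s has a square integrable weak gradient only for almost every s, and
    -- this is all that the averaged argument asks for.
    filter_upwards [hres H.weak_grad, hres (ae_memLp_slice H.grad_memLp),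
      hres (ae_memLp_slice H.drift_memLp), ae_restrict_mem measurableSet_Ioo]
      with s hWG hAs hhs hsI τ hτ
    have hs : s ∈ Icc 0 T := ⟨ha.1.le.trans hsI.1.le, hsI.2.le⟩
    have hTest := H.isTestFunction_truncatedTest hζ hd hs hAs hWG
    have hm : min (s + τ) T ∈ Icc s T := ⟨le_min (by linarith) hsI.2.le, min_le_right _ _⟩
    have hle' : spaceTimeMeasure μ s (min (s + τ) T) ≤ spaceTimeMeasure μ 0 T :=
      spaceTimeMeasure_mono μ hs.1 (min_le_right _ _)
    rw [hYin s hs, hYmin _ (by linarith [hs.1])]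
    refine (H.truncatedEnergy_sub_le hζ hd hs hAs hWG hm).trans_eq ?_
    have e1 : ∀ z : ℝ × X, inner ℝ (truncatedTestGrad d k ζ Dζ w A (s, z.2))
        (S.indicator (fun z : ℝ × X => -(ε • A z.1 z.2)) z) =
        S.indicator (fun z : ℝ × X => inner ℝ (truncatedTestGrad d k ζ Dζ w A (s, z.2))
          (-(ε • A z.1 z.2))) z := fun z => by
      by_cases hz : z ∈ S <;> simp [hz]
    have e2 : ∀ z : ℝ × X, inner ℝ (truncatedTest d k ζ w (s, z.2))
        (S.indicator (fun z : ℝ × X => -h z.1 z.2) z) =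
        S.indicator (fun z : ℝ × X => inner ℝ (truncatedTest d k ζ w (s, z.2)) (-h z.1 z.2)) z :=
      fun z => by
      by_cases hz : z ∈ S <;> simp [hz]
    simp_rw [e1, e2]
    have j1 : MemLp (fun z : ℝ × X => truncatedTestGrad d k ζ Dζ w A (s, z.2)) 2
        (spaceTimeMeasure μ s (min (s + τ) T)) := hTest.grad_memLp.comp_snd _
    have j2 : MemLp (fun z : ℝ × X => truncatedTest d k ζ w (s, z.2)) 2
        (spaceTimeMeasure μ s (min (s + τ) T)) := hTest.memLp_two.comp_snd _
    rw [hind hs.1, hind hs.1, ← integral_add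
      (j1.integrable_inner_real (hP0.mono_measure hle'))
      (j2.integrable_inner_real (hP0'.mono_measure hle')), ← integral_neg]
    refine integral_congr_ae (ae_of_all _ fun z => ?_)
    simp only [inner_neg_right, inner_smul_right, real_inner_comm (A z.1 z.2)]
    simp
    ring

/-- The energy of the positive part of `w - k` is controlled by its integral in time. -/
theorem integral_posPart_sq_le (H : IsEnergySubsolution μ WG ε T h k w A) (hε : 0 < ε) {M : ℝ}
    (hM : ∀ᵐ z ∂(spaceTimeMeasure μ 0 T), |h z.1 z.2| ≤ M * ‖A z.1 z.2‖)
    {ζ : ℕ → X → ℝ} {Dζ : ℕ → X → Euc n} {δ : ℕ → ℝ} (hδ : Tendsto δ atTop (𝓝 0))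
    (hζ : ∀ i, IsSpatialCutoff WG (δ i) (ζ i) (Dζ i))
    (hζ1 : ∀ x, Tendsto (fun i => ζ i x) atTop (𝓝 1)) {a : ℝ} (ha : a ∈ Ioo 0 T) :
    ∫ x, max (w a x - k a) 0 ^ 2 ∂μ ≤ M ^ 2 / (2 * ε) *
      ∫ z, max (w z.1 z.2 - k z.1) 0 ^ 2 ∂(spaceTimeMeasure μ a T) := by
  have haI : a ∈ Icc 0 T := ⟨ha.1.le, ha.2.le⟩
  have hle : spaceTimeMeasure μ a T ≤ spaceTimeMeasure μ 0 T :=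
    spaceTimeMeasure_mono μ ha.1.le le_rfl
  set d : ℕ → ℝ := fun i => 1 / ((i : ℝ) + 1) with hdef
  have hd : ∀ i, 0 < d i := fun i => by positivity
  have hd0 : Tendsto d atTop (𝓝[>] 0) := tendsto_nhdsWithin_iff.2
    ⟨tendsto_one_div_add_atTop_nhds_zero_nat, Eventually.of_forall hd⟩
  obtain ⟨D, hD⟩ := hδ.bddAbove_range
  have hδD : ∀ i, δ i ≤ D := fun i => hD ⟨i, rfl⟩
  have hL : Tendsto (fun i => truncatedEnergy μ (d i) k (ζ i) w a) atTop
      (𝓝 (∫ x, max (w a x - k a) 0 ^ 2 / 2 ∂μ)) := by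
    refine tendsto_integral_of_dominated_convergence (fun x => (w a x) ^ 2)
      (fun i => (H.integrable_truncatedEnergy (hζ i) (hd i) haI).1)
      (H.slice_memLp a haI).integrable_sq (fun i => ae_of_all _ fun x => ?_)
      (ae_of_all _ fun x => ?_)
    · rw [norm_mul, Real.norm_of_nonneg (softRampPrimitive_nonneg (hd i) _),
        Real.norm_of_nonneg ((hζ i).nonneg _)]
      exact (mul_le_of_le_one_right (softRampPrimitive_nonneg (hd i) _) ((hζ i).le_one _)).trans
        (softRampPrimitive_sub_le_sq (hd i) (H.level_nonneg a))
    · simpa using ((tendsto_softRampPrimitive (w a x - k a)).comp hd0).mul (hζ1 x)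
  have hw := H.memLp.mono_measure hle
  have hA := H.grad_memLp.mono_measure hle
  have hh := H.drift_memLp.mono_measure hle
  have hR : Tendsto (fun i => ∫ z, -(ε * inner ℝ (A z.1 z.2)
        (truncatedTestGrad (d i) k (ζ i) (Dζ i) w A z) +
        h z.1 z.2 * truncatedTest (d i) k (ζ i) w z) ∂(spaceTimeMeasure μ a T)) atTop
      (𝓝 (∫ z, -(ε * inner ℝ (A z.1 z.2)
        ((if 0 < w z.1 z.2 - k z.1 then (1 : ℝ) else 0) • A z.1 z.2) +
        h z.1 z.2 * max (w z.1 z.2 - k z.1) 0) ∂(spaceTimeMeasure μ a T))) := by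
    refine tendsto_integral_of_dominated_convergence
      (fun z => ε * (‖A z.1 z.2‖ * (‖A z.1 z.2‖ + D * |w z.1 z.2|)) + |h z.1 z.2| * |w z.1 z.2|)
      (fun i => ?_) ?_ (fun i => ae_of_all _ fun z => ?_) (ae_of_all _ fun z => ?_)
    · have h1 := (H.memLp_truncatedTestGrad (hζ i) (hd i)).mono_measure hle
      have h2 := (H.memLp_truncatedTest (hζ i) (hd i)).mono_measure hle
      exact (((hA.1.inner h1.1).const_mul ε).add (hh.1.mul h2.1)).neg
    · exact ((hA.norm.integrable_mul (hA.norm.add (hw.norm.const_mul D))).const_mul ε).add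
        (hh.norm.integrable_mul hw.norm)
    · rw [norm_neg]
      refine (norm_add_le _ _).trans (add_le_add ?_ ?_)
      · rw [norm_mul, Real.norm_of_nonneg hε.le]
        refine mul_le_mul_of_nonneg_left ((norm_inner_le_norm _ _).trans ?_) hε.le
        refine mul_le_mul_of_nonneg_left ?_ (norm_nonneg _)
        refine (norm_truncatedTestGrad_le (hζ i) (hd i) z (H.level_nonneg _)).trans ?_
        gcongr
        exact hδD i
      · rw [norm_mul, Real.norm_eq_abs]
        refine mul_le_mul_of_nonneg_left ?_ (abs_nonneg _)
        rw [truncatedTest, norm_mul, Real.norm_of_nonneg (softRamp_nonneg (hd i) _),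
          Real.norm_of_nonneg ((hζ i).nonneg _)]
        exact (mul_le_of_le_one_right (softRamp_nonneg (hd i) _) ((hζ i).le_one _)).trans
          (softRamp_sub_le_abs (hd i) (H.level_nonneg _))
    · have t1 : Tendsto (fun i => truncatedTest (d i) k (ζ i) w z) atTop
          (𝓝 (max (w z.1 z.2 - k z.1) 0)) := by
        have := ((tendsto_softRamp (w z.1 z.2 - k z.1)).comp hd0).mul (hζ1 z.2)
        rw [mul_one] at this
        exact this
      -- On the set w = k the slope is zero for every d, so the limit is the indicator of strict
      -- positivity.
      have t2 : Tendsto (fun i => (softRampDeriv (d i) (w z.1 z.2 - k z.1) * ζ i z.2) • A z.1 z.2)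
          atTop (𝓝 ((if 0 < w z.1 z.2 - k z.1 then (1 : ℝ) else 0) • A z.1 z.2)) := by
        have := ((tendsto_softRampDeriv (w z.1 z.2 - k z.1)).comp hd0).mul (hζ1 z.2)
        rw [mul_one] at this
        exact this.smul_const _
      have t3 : Tendsto (fun i => softRamp (d i) (w z.1 z.2 - k z.1) • Dζ i z.2) atTop (𝓝 0) := by
        have hg : Tendsto (fun i => Dζ i z.2) atTop (𝓝 0) :=
          squeeze_zero_norm (fun i => (hζ i).grad_le z.2) hδ
        simpa using ((tendsto_softRamp (w z.1 z.2 - k z.1)).comp hd0).smul hg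
      have t4 := t2.add t3
      rw [add_zero] at t4
      exact (((tendsto_const_nhds.inner t4).const_mul ε).add (t1.const_mul _)).neg
  have hlim := le_of_tendsto_of_tendsto' hL hR fun i => H.truncatedEnergy_le (hζ i) (hd i) ha
  have hfin : ∫ z, -(ε * inner ℝ (A z.1 z.2)
        ((if 0 < w z.1 z.2 - k z.1 then (1 : ℝ) else 0) • A z.1 z.2) +
        h z.1 z.2 * max (w z.1 z.2 - k z.1) 0) ∂(spaceTimeMeasure μ a T) ≤
      ∫ z, M ^ 2 / (4 * ε) * max (w z.1 z.2 - k z.1) 0 ^ 2 ∂(spaceTimeMeasure μ a T) := by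
    have hRi := ((H.integrable_posPart_sq).mono_measure hle).const_mul (M ^ 2 / (4 * ε))
    by_cases hLi : Integrable (fun z : ℝ × X => -(ε * inner ℝ (A z.1 z.2)
        ((if 0 < w z.1 z.2 - k z.1 then (1 : ℝ) else 0) • A z.1 z.2) +
        h z.1 z.2 * max (w z.1 z.2 - k z.1) 0)) (spaceTimeMeasure μ a T)
    · refine integral_mono_ae hLi hRi ?_
      filter_upwards [ae_mono hle hM] with z hz
      exact neg_energy_density_le hε hz
    -- Without integrability the left integral is zero by convention, and the right side is
    -- nonnegative.
    · rw [integral_undef hLi]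
      exact integral_nonneg fun z => by positivity
  rw [integral_const_mul] at hfin
  rw [integral_div] at hlim
  -- The factor 2 undoes the 1/2 in the limit (w - k)₊²/2 of the primitive.
  have : M ^ 2 / (2 * ε) = 2 * (M ^ 2 / (4 * ε)) := by field_simp; norm_num
  rw [this, mul_assoc]
  linarith

/-- The weak maximum principle: an energy subsolution is nonpositive. -/
theorem le_level (H : IsEnergySubsolution μ WG ε T h k w A) (hε : 0 < ε) {M : ℝ}
    (hM : ∀ᵐ z ∂(spaceTimeMeasure μ 0 T), |h z.1 z.2| ≤ M * ‖A z.1 z.2‖)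
    {ζ : ℕ → X → ℝ} {Dζ : ℕ → X → Euc n} {δ : ℕ → ℝ} (hδ : Tendsto δ atTop (𝓝 0))
    (hζ : ∀ i, IsSpatialCutoff WG (δ i) (ζ i) (Dζ i))
    (hζ1 : ∀ x, Tendsto (fun i => ζ i x) atTop (𝓝 1)) {t : ℝ} (ht : t ∈ Ioo 0 T) :
    ∀ᵐ x ∂μ, w t x ≤ k t := by
  have hi := H.integrable_posPart_sq
  have hzero := eq_zero_of_le_mul_integral_Ioo (y := fun a => ∫ x, max (w a x - k a) 0 ^ 2 ∂μ)
    (C := M ^ 2 / (2 * ε)) (T := T) (by positivity) hi.integral_prod_left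
    (fun a _ => integral_nonneg fun x => sq_nonneg _) (fun a ha => ?_) ht
  · have hw := H.slice_memLp t ⟨ht.1.le, ht.2.le⟩
    have hit : Integrable (fun x => max (w t x - k t) 0 ^ 2) μ := by
      refine hw.integrable_sq.mono' ?_ (ae_of_all _ fun x => ?_)
      · exact (Continuous.comp_aestronglyMeasurable (g := fun a : ℝ => max a 0 ^ 2) (by fun_prop)
          (hw.1.sub aestronglyMeasurable_const))
      · rw [Real.norm_of_nonneg (sq_nonneg _), ← sq_abs (w t x)]
        exact pow_le_pow_left₀ (le_max_right _ _) (max_sub_zero_le_abs (H.level_nonneg _)) 2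
    have h0 := (integral_eq_zero_iff_of_nonneg (fun x => sq_nonneg _) hit).1 hzero
    filter_upwards [h0] with x hx
    have : max (w t x - k t) 0 = 0 := by simpa using hx
    linarith [le_max_left (w t x - k t) 0]
  · refine (H.integral_posPart_sq_le hε hM hδ hζ hζ1 ha).trans_eq ?_
    congr 1
    exact integral_prod _ (hi.mono_measure (spaceTimeMeasure_mono μ ha.1.le le_rfl))

end IsEnergySubsolution

end Comparison

/-! ### Source terms in L¹(0, T; L^∞) -/

theorem MeasureTheory.MemLp.ae_norm_le_toReal {X : Type*} [MeasurableSpace X]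
    {μ : Measure X} {f : X → ℝ} (hf : MemLp f ⊤ μ) :
    ∀ᵐ x ∂μ, ‖f x‖ ≤ (eLpNorm f ⊤ μ).toReal := by
  filter_upwards [ae_le_eLpNormEssSup (f := f) (μ := μ)] with x hx
  rw [← toReal_enorm]
  exact ENNReal.toReal_mono hf.2.ne (by simpa using hx)

section MixedNorm

variable {X : Type*} [MeasurableSpace X] {μ : Measure X} [SFinite μ] {T : ℝ}

/-- The essential supremum of a slice is at most c exactly when the slice of {c < |f|} is null, and
the measure of slices is measurable in t. -/
theorem measurable_eLpNorm_top_slice {f : ℝ × X → ℝ} (hf : Measurable f) :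
    Measurable fun t => eLpNorm (fun x => f (t, x)) ⊤ μ := by
  refine measurable_of_Iic fun c => ?_
  have hs : MeasurableSet {z : ℝ × X | c < ‖f z‖ₑ} := measurableSet_lt measurable_const hf.enorm
  have : (fun t => eLpNorm (fun x => f (t, x)) ⊤ μ) ⁻¹' Iic c =
      (fun t => μ (Prod.mk t ⁻¹' {z : ℝ × X | c < ‖f z‖ₑ})) ⁻¹' {0} := by
    ext t
    simp only [mem_preimage, mem_Iic, mem_singleton_iff, eLpNorm_exponent_top]
    constructor
    · intro h
      have : ∀ᵐ x ∂μ, ‖f (t, x)‖ₑ ≤ c :=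
        (ae_le_eLpNormEssSup (f := fun x => f (t, x)) (μ := μ)).mono fun x hx => hx.trans h
      simpa [ae_iff] using this
    · intro h
      refine eLpNormEssSup_le_of_ae_enorm_bound ?_
      simpa [ae_iff] using h
  rw [this]
  exact measurable_measure_prodMk_left hs (measurableSet_singleton 0)

theorem aemeasurable_eLpNorm_top_slice {ν : Measure ℝ} [SFinite ν] {f : ℝ → X → ℝ}
    (hf : AEStronglyMeasurable (fun z : ℝ × X => f z.1 z.2) (ν.prod μ)) :
    AEMeasurable (fun t => eLpNorm (f t) ⊤ μ) ν := by
  refine ⟨_, measurable_eLpNorm_top_slice (μ := μ) hf.stronglyMeasurable_mk.measurable, ?_⟩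
  filter_upwards [Measure.ae_ae_of_ae_prod hf.ae_eq_mk] with t ht
  exact eLpNorm_congr_ae ht

namespace MemL1Linf

variable {f f₁ f₂ : ℝ → X → ℝ} {ψ : X → ℝ}

theorem sub (h₁ : MemL1Linf μ T f₁) (h₂ : MemL1Linf μ T f₂) : MemL1Linf μ T (f₁ - f₂) := by
  refine ⟨h₁.1.sub h₂.1, ?_⟩
  have hm := aemeasurable_eLpNorm_top_slice h₁.1
  calc ∫⁻ t in Ioo 0 T, eLpNorm ((f₁ - f₂) t) ⊤ μ
      ≤ ∫⁻ t in Ioo 0 T, (eLpNorm (f₁ t) ⊤ μ + eLpNorm (f₂ t) ⊤ μ) := by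
        refine lintegral_mono_ae ?_
        filter_upwards [h₁.1.prodMk_left, h₂.1.prodMk_left] with t ht1 ht2
        exact eLpNorm_sub_le ht1 ht2 le_top
    _ = _ := lintegral_add_left' hm _
    _ < ⊤ := ENNReal.add_lt_top.2 ⟨h₁.2, h₂.2⟩

theorem integrable_norm (h : MemL1Linf μ T f) :
    IntegrableOn (fun t => (eLpNorm (f t) ⊤ μ).toReal) (Ioo 0 T) volume :=
  integrable_toReal_of_lintegral_ne_top (aemeasurable_eLpNorm_top_slice h.1) h.2.ne

theorem ae_memLp (h : MemL1Linf μ T f) :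
    ∀ᵐ t ∂(volume.restrict (Ioo 0 T)), MemLp (f t) ⊤ μ := by
  filter_upwards [h.1.prodMk_left, ae_lt_top' (aemeasurable_eLpNorm_top_slice h.1) h.2.ne]
    with t h1 h2 using ⟨h1, h2⟩

theorem integrable_mul (h : MemL1Linf μ T f) (hψ : Integrable ψ μ) :
    Integrable (fun z : ℝ × X => f z.1 z.2 * ψ z.2) (spaceTimeMeasure μ 0 T) := by
  have hm : AEStronglyMeasurable (fun z : ℝ × X => f z.1 z.2 * ψ z.2) (spaceTimeMeasure μ 0 T) :=
    h.1.mul hψ.1.comp_snd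
  refine (integrable_prod_iff hm).2 ⟨?_, ?_⟩
  · filter_upwards [h.ae_memLp] with t ht
    exact hψ.bdd_mul ht.1 ht.ae_norm_le_toReal
  · refine Integrable.mono' (h.integrable_norm.mul_const (∫ x, ‖ψ x‖ ∂μ))
      hm.norm.integral_prod_right' ?_
    filter_upwards [h.ae_memLp] with t ht
    rw [Real.norm_of_nonneg (integral_nonneg fun x => norm_nonneg _), ← integral_const_mul]
    refine integral_mono_of_nonneg (ae_of_all _ fun x => norm_nonneg _) (hψ.norm.const_mul _) ?_
    filter_upwards [ht.ae_norm_le_toReal] with x hx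
    rw [norm_mul]
    exact mul_le_mul_of_nonneg_right hx (norm_nonneg _)

/-- Fubini with the slicewise L^∞ bound. Nonnegativity of ψ gives a one-sided estimate with the
plain mass of ψ, the form that the level k absorbs. -/
theorem integral_mul_le (h : MemL1Linf μ T f) (hψ : Integrable ψ μ) (hψ0 : ∀ x, 0 ≤ ψ x)
    {a b : ℝ} (ha : 0 ≤ a) (hb : b ≤ T) :
    ∫ z, f z.1 z.2 * ψ z.2 ∂(spaceTimeMeasure μ a b) ≤
      (∫ t in Ioo a b, (eLpNorm (f t) ⊤ μ).toReal) * ∫ x, ψ x ∂μ := by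
  have hi := (h.integrable_mul hψ).mono_measure (spaceTimeMeasure_mono μ ha hb)
  have hsub : Ioo a b ⊆ Ioo 0 T := Ioo_subset_Ioo ha hb
  rw [spaceTimeMeasure, integral_prod _ hi, ← integral_mul_const]
  refine integral_mono_ae hi.integral_prod_left
    ((h.integrable_norm.mono_set hsub).mul_const _) ?_
  filter_upwards [ae_restrict_of_ae_restrict_of_subset hsub h.ae_memLp] with t ht
  rw [← integral_const_mul]
  refine integral_mono_ae (hψ.bdd_mul ht.1 ht.ae_norm_le_toReal) (hψ.const_mul _) ?_
  filter_upwards [ht.ae_norm_le_toReal] with x hx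
  exact mul_le_mul_of_nonneg_right ((le_abs_self _).trans hx) (hψ0 x)

end MemL1Linf

end MixedNorm

/-! ### Linearization and the difference of two energy solutions -/

/-- A differentiable function whose gradient is integrable along a segment has increment over the
segment bounded by the mean gradient. -/
theorem abs_sub_le_norm_linearizedDrift_mul {n : ℕ} {h : Euc n → ℝ} (hd : Differentiable ℝ h)
    {p₁ p₂ : Euc n}
    (hi : IntervalIntegrable (fun θ : ℝ => gradient h (θ • p₁ + (1 - θ) • p₂)) volume 0 1) :
    |h p₁ - h p₂| ≤ ‖linearizedDrift h p₁ p₂‖ * ‖p₁ - p₂‖ := by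
  have hγ : ∀ θ : ℝ, HasDerivAt (fun θ : ℝ => θ • p₁ + (1 - θ) • p₂) (p₁ - p₂) θ := fun θ => by
    have h1 := (hasDerivAt_id θ).smul_const p₁
    have h2 := ((hasDerivAt_id θ).const_sub 1).smul_const p₂
    convert! h1.add h2 using 1
    simp [sub_eq_add_neg]
  have hder : ∀ θ : ℝ, HasDerivAt (fun θ : ℝ => h (θ • p₁ + (1 - θ) • p₂))
      (inner ℝ (p₁ - p₂) (gradient h (θ • p₁ + (1 - θ) • p₂))) θ := fun θ => by
    have := (hd (θ • p₁ + (1 - θ) • p₂)).hasFDerivAt.comp_hasDerivAt θ (hγ θ)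
    rwa [← inner_gradient_left, real_inner_comm] at this
  have hi' : IntervalIntegrable (fun θ : ℝ =>
      inner ℝ (p₁ - p₂) (gradient h (θ • p₁ + (1 - θ) • p₂))) volume 0 1 :=
    ⟨hi.1.const_inner _, hi.2.const_inner _⟩
  have h1 := intervalIntegral.integral_eq_sub_of_hasDerivAt (fun θ _ => hder θ) hi'
  have h2 := (innerSL ℝ (p₁ - p₂)).intervalIntegral_comp_comm hi
  simp only [innerSL_apply_apply] at h2
  simp only [one_smul, sub_self, zero_smul, add_zero, sub_zero, zero_add] at h1
  rw [← h1, h2, mul_comm]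
  exact abs_real_inner_le_norm _ _

theorem integral_spaceTimeMeasure_sub {X : Type*} [MeasurableSpace X] {μ : Measure X} [SFinite μ]
    {T : ℝ} {F : ℝ × X → ℝ}
    (hF : Integrable F (spaceTimeMeasure μ 0 T)) {s t : ℝ} (hs : 0 ≤ s) (hst : s ≤ t)
    (htT : t ≤ T) :
    ∫ z, F z ∂(spaceTimeMeasure μ s T) - ∫ z, F z ∂(spaceTimeMeasure μ t T) =
      ∫ z, F z ∂(spaceTimeMeasure μ s t) := by
  have hi : ∀ {a b : ℝ}, 0 ≤ a → a ≤ b → b ≤ T →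
      IntervalIntegrable (fun τ => ∫ x, F (τ, x) ∂μ) volume a b ∧
      ∫ z, F z ∂(spaceTimeMeasure μ a b) = ∫ τ in a..b, ∫ x, F (τ, x) ∂μ := by
    intro a b ha hab hb
    have h1 := hF.mono_measure (spaceTimeMeasure_mono μ ha hb)
    refine ⟨?_, ?_⟩
    · rw [intervalIntegrable_iff_integrableOn_Ioo_of_le hab]
      exact h1.integral_prod_left
    · rw [intervalIntegral.integral_of_le hab, integral_Ioc_eq_integral_Ioo]
      exact integral_prod _ h1
  obtain ⟨i1, e1⟩ := hi hs hst htT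
  obtain ⟨i2, e2⟩ := hi (hs.trans hst) htT le_rfl
  rw [(hi hs (hst.trans htT) le_rfl).2, e1, e2,
    ← intervalIntegral.integral_add_adjacent_intervals i1 i2]
  ring

theorem IsEnergySolution.integrable_inner {n : ℕ} {X : Type*} [MeasurableSpace X] [Bornology X]
    {μ : Measure X} [SFinite μ] {WG : (X → ℝ) → (X → Euc n) → Prop} {ε T : ℝ}
    {H : ℝ → X → Euc n → ℝ} {f : ℝ → X → ℝ} {g : X → ℝ} {u : ℝ → X → ℝ} {Du : ℝ → X → Euc n}
    {ψ : X → ℝ} {Dψ : X → Euc n}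
    (hu : IsEnergySolution μ WG ε T H f g u Du)
    (hψ : IsTestFunction μ WG ψ Dψ) :
    Integrable (fun z : ℝ × X => inner ℝ (Du z.1 z.2) (Dψ z.2)) (spaceTimeMeasure μ 0 T) :=
  hu.grad_memLp.integrable_inner_real (hψ.grad_memLp.comp_snd _)

section EnergySolution

variable {n : ℕ} {X : Type*} [PseudoMetricSpace X] [MeasurableSpace X] [BorelSpace X]
  {μ : Measure X}
  {WG : (X → ℝ) → (X → Euc n) → Prop} {ε T : ℝ} {H : ℝ → X → Euc n → ℝ}

namespace IsTestFunction

variable {ψ : X → ℝ} {Dψ : X → Euc n}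

theorem integrable_mul (h : IsTestFunction μ WG ψ Dψ) {F : ℝ × X → ℝ}
    (hF : ∀ S : Set X, MeasurableSet S → Bornology.IsBounded S →
      IntegrableOn F (univ ×ˢ S) (spaceTimeMeasure μ 0 T)) :
    Integrable (fun z : ℝ × X => F z * ψ z.2) (spaceTimeMeasure μ 0 T) := by
  -- ψ is only almost everywhere measurable, so its support may fail to be measurable; the closure
  -- is measurable and still bounded.
  set S := closure (Function.support ψ) with hS
  have hb : ∀ᵐ z ∂(spaceTimeMeasure μ 0 T), ‖ψ z.2‖ ≤ (eLpNorm ψ ⊤ μ).toReal :=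
    Measure.quasiMeasurePreserving_snd.ae h.memLp_top.ae_norm_le_toReal
  have hm : AEStronglyMeasurable (fun z : ℝ × X => ψ z.2) (spaceTimeMeasure μ 0 T) :=
    h.memLp_two.1.comp_snd
  have h1 : IntegrableOn (fun z : ℝ × X => F z * ψ z.2) (univ ×ˢ S) (spaceTimeMeasure μ 0 T) :=
    (hF S isClosed_closure.measurableSet h.bounded_support.closure).mul_bdd hm.restrict
      (ae_restrict_of_ae hb)
  refine (integrableOn_iff_integrable_of_support_subset fun z hz => ?_).1 h1
  exact ⟨trivial, subset_closure (right_ne_zero_of_mul hz)⟩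

variable [ProperSpace X] [IsLocallyFiniteMeasure μ]

theorem integrable (h : IsTestFunction μ WG ψ Dψ) : Integrable ψ μ := by
  set S := closure (Function.support ψ) with hS
  have hfin : IsFiniteMeasure (μ.restrict S) :=
    ⟨by simpa using h.bounded_support.closure.measure_lt_top⟩
  have h1 : IntegrableOn ψ S μ :=
    memLp_one_iff_integrable.1 ((h.memLp_top.mono_measure Measure.restrict_le_self).mono_exponent
      le_top)
  exact (integrableOn_iff_integrable_of_support_subset subset_closure).1 h1

end IsTestFunction

namespace IsEnergySolution

variable {f f₁ f₂ : ℝ → X → ℝ} {g g₁ g₂ : X → ℝ} {u u₁ u₂ : ℝ → X → ℝ}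
  {Du Du₁ Du₂ : ℝ → X → Euc n} {ψ : X → ℝ} {Dψ : X → Euc n}

/-- Local integrability gives measurability on each bounded cylinder, and countably many balls
exhaust X. -/
theorem aestronglyMeasurable_hamiltonian (hu : IsEnergySolution μ WG ε T H f g u Du) :
    AEStronglyMeasurable (fun z : ℝ × X => H z.1 z.2 (Du z.1 z.2)) (spaceTimeMeasure μ 0 T) := by
  rcases isEmpty_or_nonempty X with hX | ⟨⟨x₀⟩⟩
  · have : IsEmpty (ℝ × X) := inferInstance
    rw [Measure.eq_zero_of_isEmpty (spaceTimeMeasure μ 0 T)]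
    exact aestronglyMeasurable_zero_measure _
  · have hU : (⋃ i : ℕ, (univ : Set ℝ) ×ˢ Metric.closedBall x₀ i) = univ := by
      rw [← prod_iUnion, Metric.iUnion_closedBall_nat, univ_prod_univ]
    rw [← Measure.restrict_univ (μ := spaceTimeMeasure μ 0 T), ← hU, aestronglyMeasurable_iUnion_iff]
    exact fun i => (hu.hamiltonian_integrable _ measurableSet_closedBall
      Metric.isBounded_closedBall).1

variable [ProperSpace X] [IsLocallyFiniteMeasure μ]

theorem integral_sub_integral (hu : IsEnergySolution μ WG ε T H f g u Du)
    (hf : MemL1Linf μ T f) (hψ : IsTestFunction μ WG ψ Dψ) {s t : ℝ} (hs : s ∈ Icc 0 T)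
    (ht : t ∈ Icc s T) :
    ∫ x, u s x * ψ x ∂μ - ∫ x, u t x * ψ x ∂μ =
      ∫ z, f z.1 z.2 * ψ z.2 ∂(spaceTimeMeasure μ s t) -
        ε * ∫ z, inner ℝ (Du z.1 z.2) (Dψ z.2) ∂(spaceTimeMeasure μ s t) -
        ∫ z, H z.1 z.2 (Du z.1 z.2) * ψ z.2 ∂(spaceTimeMeasure μ s t) := by
  have i1 := (hu.integrable_inner hψ).const_mul ε
  have i2 := hψ.integrable_mul hu.hamiltonian_integrable
  have i3 := hf.integrable_mul hψ.integrable
  have hle := spaceTimeMeasure_mono μ hs.1 ht.2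
  have h1 := hu.equation ψ Dψ hψ s hs
  have h2 := hu.equation ψ Dψ hψ t ⟨hs.1.trans ht.1, ht.2⟩
  have h3 := integral_spaceTimeMeasure_sub ((i1.add i2).sub i3) hs.1 ht.1 ht.2
  have h4 := integral_sub ((i1.add i2).mono_measure hle) (i3.mono_measure hle)
  have h5 := integral_add (i1.mono_measure hle) (i2.mono_measure hle)
  rw [integral_const_mul] at h5
  simp only [Pi.add_apply, Pi.sub_apply] at h3 h4
  linarith

/-- The difference of two energy solutions is an energy subsolution relative to the level given by
the data. -/
theorem isEnergySubsolution_sub (hWG : ∀ v₁ v₂ G₁ G₂, WG v₁ G₁ → WG v₂ G₂ → WG (v₁ - v₂) (G₁ - G₂))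
    (hf₁ : MemL1Linf μ T f₁) (hf₂ : MemL1Linf μ T f₂)
    (hg₁ : MemLp g₁ ⊤ μ) (hg₂ : MemLp g₂ ⊤ μ)
    (hu₁ : IsEnergySolution μ WG ε T H f₁ g₁ u₁ Du₁)
    (hu₂ : IsEnergySolution μ WG ε T H f₂ g₂ u₂ Du₂) {M : ℝ}
    (hM : ∀ᵐ z ∂(spaceTimeMeasure μ 0 T), |H z.1 z.2 (Du₁ z.1 z.2) - H z.1 z.2 (Du₂ z.1 z.2)| ≤
      M * ‖Du₁ z.1 z.2 - Du₂ z.1 z.2‖) :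
    IsEnergySubsolution μ WG ε T (fun t x => H t x (Du₁ t x) - H t x (Du₂ t x))
      (fun t => (eLpNorm (g₁ - g₂) ⊤ μ).toReal + ∫ s in (min t T)..T,
        (Ioo 0 T).indicator (fun s => (eLpNorm ((f₁ - f₂) s) ⊤ μ).toReal) s)
      (u₁ - u₂) (Du₁ - Du₂) := by
  have hF := hf₁.sub hf₂
  set φ : ℝ → ℝ := (Ioo 0 T).indicator (fun s => (eLpNorm ((f₁ - f₂) s) ⊤ μ).toReal) with hφ
  have hφi : Integrable φ volume := (integrable_indicator_iff measurableSet_Ioo).2 hF.integrable_norm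
  have hφ0 : ∀ s, 0 ≤ φ s := fun s => indicator_nonneg (fun _ _ => ENNReal.toReal_nonneg) s
  have hφI : ∀ a b, IntervalIntegrable φ volume a b := fun a b => hφi.intervalIntegrable
  constructor
  · exact fun t ht => (hu₁.slice_memLp t ht).sub (hu₂.slice_memLp t ht)
  · intro t ht
    have h1 := (hu₁.continuous_in_time t ht).add (hu₂.continuous_in_time t ht)
    rw [add_zero] at h1
    refine tendsto_of_tendsto_of_tendsto_of_le_of_le' tendsto_const_nhds h1
      (Eventually.of_forall fun _ => zero_le) ?_
    filter_upwards [self_mem_nhdsWithin] with s hs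
    have e : (u₁ - u₂) s - (u₁ - u₂) t = (u₁ s - u₁ t) - (u₂ s - u₂ t) := by
      simp only [Pi.sub_apply]
      abel
    rw [e]
    exact eLpNorm_sub_le ((hu₁.slice_memLp s hs).sub (hu₁.slice_memLp t ht)).1
      ((hu₂.slice_memLp s hs).sub (hu₂.slice_memLp t ht)).1 (by norm_num)
  · exact hu₁.memLp.sub hu₂.memLp
  · exact hu₁.grad_memLp.sub hu₂.grad_memLp
  -- The difference of the Hamiltonians inherits square integrability from Dw through the linear
  -- bound.
  · exact (hu₁.grad_memLp.sub hu₂.grad_memLp).of_le_mul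
      (hu₁.aestronglyMeasurable_hamiltonian.sub hu₂.aestronglyMeasurable_hamiltonian) hM
  · filter_upwards [hu₁.weak_grad, hu₂.weak_grad] with t h1 h2 using hWG _ _ _ _ h1 h2
  · have hc : Continuous fun a => ∫ s in a..T, φ s := by
      have := intervalIntegral.continuous_primitive hφI T
      simp_rw [fun a => intervalIntegral.integral_symm (f := φ) (μ := volume) T a]
      exact this.neg
    exact continuous_const.add (hc.comp (continuous_id.min continuous_const))
  -- The minimum with T in the level makes it nonnegative for times beyond T as well.
  · exact fun t => add_nonneg ENNReal.toReal_nonneg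
      (intervalIntegral.integral_nonneg (min_le_right _ _) fun s _ => hφ0 s)
  · filter_upwards [hu₁.terminal, hu₂.terminal, (hg₁.sub hg₂).ae_norm_le_toReal] with x h1 h2 h3
    simp only [min_self, intervalIntegral.integral_same, add_zero, Pi.sub_apply, h1, h2]
    exact (le_abs_self _).trans h3
  · intro ψ Dψ hψ hψ0 s hs t ht
    have ht' : t ∈ Icc 0 T := ⟨hs.1.trans ht.1, ht.2⟩
    have hle := spaceTimeMeasure_mono μ hs.1 ht.2
    have e1 := hu₁.integral_sub_integral hf₁ hψ hs ht
    have e2 := hu₂.integral_sub_integral hf₂ hψ hs ht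
    have hFle := hF.integral_mul_le hψ.integrable hψ0 hs.1 ht.2
    have hk : ∫ s in Ioo s t, (eLpNorm ((f₁ - f₂) s) ⊤ μ).toReal =
        (∫ s in (min s T)..T, φ s) - ∫ s in (min t T)..T, φ s := by
      rw [min_eq_left hs.2, min_eq_left ht.2, ← intervalIntegral.integral_add_adjacent_intervals
        (hφI s t) (hφI t T), add_sub_cancel_right, intervalIntegral.integral_of_le ht.1,
        integral_Ioc_eq_integral_Ioo]
      refine setIntegral_congr_fun measurableSet_Ioo fun τ hτ => ?_
      rw [hφ, indicator_of_mem (Ioo_subset_Ioo hs.1 ht.2 hτ)]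
    have p : ∀ {v : X → ℝ}, MemLp v 2 μ → Integrable (fun x => v x * ψ x) μ := fun hv =>
      hv.integrable_mul hψ.memLp_two
    have es := integral_sub (p (hu₁.slice_memLp s hs)) (p (hu₂.slice_memLp s hs))
    have et := integral_sub (p (hu₁.slice_memLp t ht')) (p (hu₂.slice_memLp t ht'))
    have ew := integral_sub ((p (hu₁.slice_memLp s hs)).sub (p (hu₂.slice_memLp s hs)))
      ((p (hu₁.slice_memLp t ht')).sub (p (hu₂.slice_memLp t ht')))
    have iA₁ := (hu₁.integrable_inner hψ).mono_measure hle
    have iA₂ := (hu₂.integrable_inner hψ).mono_measure hle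
    have iH₁ := (hψ.integrable_mul hu₁.hamiltonian_integrable).mono_measure hle
    have iH₂ := (hψ.integrable_mul hu₂.hamiltonian_integrable).mono_measure hle
    have iF₁ := (hf₁.integrable_mul hψ.integrable).mono_measure hle
    have iF₂ := (hf₂.integrable_mul hψ.integrable).mono_measure hle
    have eF := integral_sub iF₁ iF₂
    have eR := integral_add ((iA₁.sub iA₂).const_mul ε) (iH₁.sub iH₂)
    simp only [Pi.sub_apply] at eR ew
    rw [integral_const_mul, integral_sub iA₁ iA₂, integral_sub iH₁ iH₂] at eR
    simp only [Pi.sub_apply, inner_sub_left, sub_mul] at hFle ⊢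
    rw [ew, eR, es, et]
    rw [eF] at hFle
    have hk' := congrArg (· * ∫ x, ψ x ∂μ) hk
    simp only [sub_mul, Pi.sub_apply] at hk'
    linarith

/-- Comparison of energy solutions whose Hamiltonians differ at most linearly in the difference of
the gradients. -/
theorem eLpNorm_top_sub_le (hWG : ∀ v₁ v₂ G₁ G₂, WG v₁ G₁ → WG v₂ G₂ → WG (v₁ - v₂) (G₁ - G₂))
    {ζ : ℕ → X → ℝ} {Dζ : ℕ → X → Euc n} {δ : ℕ → ℝ} (hδ : Tendsto δ atTop (𝓝 0))
    (hζ : ∀ i, IsSpatialCutoff WG (δ i) (ζ i) (Dζ i))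
    (hζ1 : ∀ x, Tendsto (fun i => ζ i x) atTop (𝓝 1)) (hε : 0 < ε)
    (hg₁ : MemLp g₁ ⊤ μ) (hg₂ : MemLp g₂ ⊤ μ)
    (hf₁ : MemL1Linf μ T f₁) (hf₂ : MemL1Linf μ T f₂)
    (hu₁ : IsEnergySolution μ WG ε T H f₁ g₁ u₁ Du₁)
    (hu₂ : IsEnergySolution μ WG ε T H f₂ g₂ u₂ Du₂)
    (hb : HasBoundedDrift μ T H Du₁ Du₂) {t : ℝ} (ht : t ∈ Ioo 0 T) :
    eLpNorm (u₁ t - u₂ t) ⊤ μ ≤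
      eLpNorm (g₁ - g₂) ⊤ μ + ∫⁻ s in Ioo 0 T, eLpNorm (f₁ s - f₂ s) ⊤ μ := by
  obtain ⟨M, hM⟩ := hb
  have hM₁ : ∀ᵐ z ∂(spaceTimeMeasure μ 0 T), |H z.1 z.2 (Du₁ z.1 z.2) - H z.1 z.2 (Du₂ z.1 z.2)| ≤
      M * ‖Du₁ z.1 z.2 - Du₂ z.1 z.2‖ := by
    filter_upwards [hM] with z hz
    exact (abs_sub_le_norm_linearizedDrift_mul hz.1 hz.2.1).trans
      (mul_le_mul_of_nonneg_right hz.2.2 (norm_nonneg _))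
  have hM₂ : ∀ᵐ z ∂(spaceTimeMeasure μ 0 T), |H z.1 z.2 (Du₂ z.1 z.2) - H z.1 z.2 (Du₁ z.1 z.2)| ≤
      M * ‖Du₂ z.1 z.2 - Du₁ z.1 z.2‖ := by
    filter_upwards [hM₁] with z hz
    rwa [abs_sub_comm, norm_sub_rev]
  have hF := hf₁.sub hf₂
  have hle : ∀ {F : ℝ → X → ℝ} {K : ℝ}, MemL1Linf μ T F →
      K + ∫ s in (min t T)..T, (Ioo 0 T).indicator (fun s => (eLpNorm (F s) ⊤ μ).toReal) s ≤
      K + ∫ s in Ioo 0 T, (eLpNorm (F s) ⊤ μ).toReal := by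
    intro F K hF
    rw [min_eq_left ht.2.le, intervalIntegral.integral_of_le ht.2.le,
      ← integral_indicator (f := fun s => (eLpNorm (F s) ⊤ μ).toReal) measurableSet_Ioo]
    exact add_le_add_right (setIntegral_le_integral
      ((integrable_indicator_iff measurableSet_Ioo).2 hF.integrable_norm)
      (ae_of_all _ fun s => indicator_nonneg (fun _ _ => ENNReal.toReal_nonneg) s)) K
  -- The one-sided comparison is applied to both orders of the solutions, since the linear bound is
  -- symmetric; the two estimates give the absolute value.
  have k₁ := (isEnergySubsolution_sub hWG hf₁ hf₂ hg₁ hg₂ hu₁ hu₂ hM₁).le_level hε hM₁ hδ hζ hζ1 ht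
  have k₂ := (isEnergySubsolution_sub hWG hf₂ hf₁ hg₂ hg₁ hu₂ hu₁ hM₂).le_level hε hM₂ hδ hζ hζ1 ht
  have hbound : ∀ᵐ x ∂μ, ‖(u₁ t - u₂ t) x‖ ≤ (eLpNorm (g₁ - g₂) ⊤ μ).toReal +
      ∫ s in Ioo 0 T, (eLpNorm ((f₁ - f₂) s) ⊤ μ).toReal := by
    filter_upwards [k₁, k₂] with x h1 h2
    replace h1 := h1.trans (hle hF)
    replace h2 := h2.trans (hle (hf₂.sub hf₁))
    have es : ∀ s, eLpNorm ((f₂ - f₁) s) ⊤ μ = eLpNorm ((f₁ - f₂) s) ⊤ μ := fun s =>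
      eLpNorm_sub_comm _ _ _ _
    rw [eLpNorm_sub_comm] at h2
    simp_rw [es] at h2
    simp only [Pi.sub_apply] at h1 h2 ⊢
    rw [Real.norm_eq_abs, abs_le]
    constructor <;> linarith
  rw [eLpNorm_exponent_top]
  refine (eLpNormEssSup_le_of_ae_bound hbound).trans_eq ?_
  rw [ENNReal.ofReal_add ENNReal.toReal_nonneg (integral_nonneg fun _ => ENNReal.toReal_nonneg),
    ENNReal.ofReal_toReal (hg₁.sub hg₂).2.ne,
    integral_toReal (aemeasurable_eLpNorm_top_slice hF.1) (ae_lt_top'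
      (aemeasurable_eLpNorm_top_slice hF.1) hF.2.ne), ENNReal.ofReal_toReal hF.2.ne]
  rfl

end IsEnergySolution

end EnergySolution

/-! ### Spatial cutoffs on open sets and on the torus -/

section Cutoffs

variable {n : ℕ}

theorem isSpatialCutoff_of_contDiff {Ω : Set (Euc n)} (hΩ : IsOpen Ω) {ζ : Euc n → ℝ} {δ : ℝ}
    (hζ : ContDiff ℝ ∞ ζ) (hζc : HasCompactSupport ζ) (h0 : ∀ x, 0 ≤ ζ x) (h1 : ∀ x, ζ x ≤ 1)
    (hδ : ∀ x, ‖gradient ζ x‖ ≤ δ) :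
    IsSpatialCutoff (HasWeakGradientOn Ω) δ ζ (gradient ζ) where
  measurable := hζ.continuous.measurable
  measurable_grad := (hζ.continuous_gradient (by simp)).measurable
  nonneg := h0
  le_one := h1
  grad_le := hδ
  bounded_support := hζc.isCompact.isBounded.subset (subset_tsupport ζ)
  comp_mul v G η B C h hη hB hC := by
    convert! (h.comp hΩ hη hB hC).mul_smooth hΩ hζ using 2 with x
    rw [smul_smul, mul_comm]

/-- Dilating one bump by i + 1 divides its gradient by i + 1 and makes it equal one near any given
point eventually. The functions do not depend on Ω and need not vanish on its boundary. -/
theorem exists_cutoff_sequence (n : ℕ) : ∃ (ζ : ℕ → Euc n → ℝ) (δ : ℕ → ℝ),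
    Tendsto δ atTop (𝓝 0) ∧ (∀ x, Tendsto (fun i => ζ i x) atTop (𝓝 1)) ∧
    (∀ Ω : Set (Euc n), IsOpen Ω → ∀ i,
      IsSpatialCutoff (HasWeakGradientOn Ω) (δ i) (ζ i) (gradient (ζ i))) := by
  let χ : ContDiffBump (0 : Euc n) := ⟨1, 2, one_pos, one_lt_two⟩
  have hχ : ContDiff ℝ ∞ χ := χ.contDiff
  obtain ⟨C, hC⟩ := (χ.hasCompactSupport.fderiv ℝ).exists_bound_of_continuous
    (hχ.continuous_fderiv (by simp))
  set c : ℕ → ℝ := fun i => 1 / ((i : ℝ) + 1) with hc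
  have hc0 : ∀ i, 0 < c i := fun i => by positivity
  have hclim : Tendsto c atTop (𝓝 0) := tendsto_one_div_add_atTop_nhds_zero_nat
  refine ⟨fun i x => χ (c i • x), fun i => c i * C, by simpa using hclim.mul_const C,
    fun x => ?_, fun Ω hΩ i => isSpatialCutoff_of_contDiff hΩ
      (hχ.comp (contDiff_const_smul (c i))) (χ.hasCompactSupport.comp_smul (hc0 i).ne')
      (fun x => χ.nonneg) (fun x => χ.le_one) fun x => ?_⟩
  · refine tendsto_const_nhds.congr' ?_
    have h1 : Tendsto (fun i => ‖c i • x‖) atTop (𝓝 0) := by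
      simpa using (hclim.smul_const x).norm
    filter_upwards [h1.eventually (gt_mem_nhds one_pos)] with i hi
    exact (χ.one_of_mem_closedBall (by simpa using hi.le)).symm
  · have h1 : HasFDerivAt (fun x => χ (c i • x)) (c i • fderiv ℝ χ (c i • x)) x := by
      have := ((hχ.differentiable (by simp)) (c i • x)).hasFDerivAt.comp x
        ((hasFDerivAt_id x).const_smul (c i))
      convert! this using 1
      ext
      simp
    rw [norm_gradient, h1.fderiv, norm_smul, Real.norm_of_nonneg (hc0 i).le]
    exact mul_le_mul_of_nonneg_left (hC _) (hc0 i).le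

theorem HasWeakGradientTorus.sub {v₁ v₂ : UnitAddTorus (Fin n) → ℝ}
    {G₁ G₂ : UnitAddTorus (Fin n) → Euc n} (h₁ : HasWeakGradientTorus v₁ G₁)
    (h₂ : HasWeakGradientTorus v₂ G₂) : HasWeakGradientTorus (v₁ - v₂) (G₁ - G₂) :=
  HasWeakGradientOn.sub h₁ h₂

/-- Compactness makes localization unnecessary: the constant one has bounded support and zero
gradient. -/
theorem isSpatialCutoff_torus :
    IsSpatialCutoff (X := UnitAddTorus (Fin n)) HasWeakGradientTorus 0 (fun _ => 1)
      (fun _ => 0) where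
  measurable := measurable_const
  measurable_grad := measurable_const
  nonneg _ := zero_le_one
  le_one _ := le_rfl
  grad_le _ := by simp
  bounded_support := (isCompact_univ (X := UnitAddTorus (Fin n))).isBounded.subset (subset_univ _)
  comp_mul v G η B C h hη hB hC := by
    have := HasWeakGradientOn.comp isOpen_univ h hη hB hC
    simpa [HasWeakGradientTorus, Function.comp_def] using this

end Cutoffs

/-! ### The comparison estimate on the torus and on open sets -/

theorem mainTheorem4 (n : ℕ) (ε T : ℝ) (hε : 0 < ε) (hT : 0 < T) :
    (∀ (H : ℝ → UnitAddTorus (Fin n) → Euc n → ℝ)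
        (f₁ f₂ : ℝ → UnitAddTorus (Fin n) → ℝ) (g₁ g₂ : UnitAddTorus (Fin n) → ℝ)
        (u₁ u₂ : ℝ → UnitAddTorus (Fin n) → ℝ) (Du₁ Du₂ : ℝ → UnitAddTorus (Fin n) → Euc n),
      MemLp g₁ ∞ volume → MemLp g₂ ∞ volume →
      MemL1Linf volume T f₁ → MemL1Linf volume T f₂ →
      IsEnergySolution volume HasWeakGradientTorus ε T H f₁ g₁ u₁ Du₁ →
      IsEnergySolution volume HasWeakGradientTorus ε T H f₂ g₂ u₂ Du₂ →
      HasBoundedDrift volume T H Du₁ Du₂ →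
      ∀ t ∈ Ioo 0 T,
        eLpNorm (u₁ t - u₂ t) ∞ volume ≤
          eLpNorm (g₁ - g₂) ∞ volume + ∫⁻ s in Ioo 0 T, eLpNorm (f₁ s - f₂ s) ∞ volume) ∧
    (∀ (Ω : Set (Euc n)), IsOpen Ω →
      ∀ (H : ℝ → Euc n → Euc n → ℝ) (f₁ f₂ : ℝ → Euc n → ℝ) (g₁ g₂ : Euc n → ℝ)
        (u₁ u₂ : ℝ → Euc n → ℝ) (Du₁ Du₂ : ℝ → Euc n → Euc n),
      MemLp g₁ ∞ (volume.restrict Ω) → MemLp g₂ ∞ (volume.restrict Ω) →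
      MemL1Linf (volume.restrict Ω) T f₁ → MemL1Linf (volume.restrict Ω) T f₂ →
      IsEnergySolution (volume.restrict Ω) (HasWeakGradientOn Ω) ε T H f₁ g₁ u₁ Du₁ →
      IsEnergySolution (volume.restrict Ω) (HasWeakGradientOn Ω) ε T H f₂ g₂ u₂ Du₂ →
      HasBoundedDrift (volume.restrict Ω) T H Du₁ Du₂ →
      ∀ t ∈ Ioo 0 T,
        eLpNorm (u₁ t - u₂ t) ∞ (volume.restrict Ω) ≤
          eLpNorm (g₁ - g₂) ∞ (volume.restrict Ω) +
            ∫⁻ s in Ioo 0 T, eLpNorm (f₁ s - f₂ s) ∞ (volume.restrict Ω)) := by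
  refine ⟨?_, ?_⟩
  · intro H f₁ f₂ g₁ g₂ u₁ u₂ Du₁ Du₂ hg₁ hg₂ hf₁ hf₂ hu₁ hu₂ hb t ht
    exact IsEnergySolution.eLpNorm_top_sub_le (fun _ _ _ _ h₁ h₂ => h₁.sub h₂)
      (tendsto_const_nhds (x := (0 : ℝ))) (fun _ => isSpatialCutoff_torus)
      (fun _ => tendsto_const_nhds) hε hg₁ hg₂ hf₁ hf₂ hu₁ hu₂ hb ht
  · intro Ω hΩ H f₁ f₂ g₁ g₂ u₁ u₂ Du₁ Du₂ hg₁ hg₂ hf₁ hf₂ hu₁ hu₂ hb t ht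
    obtain ⟨ζ, δ, hδ, hζ1, hζ⟩ := exists_cutoff_sequence n
    exact IsEnergySolution.eLpNorm_top_sub_le (fun _ _ _ _ h₁ h₂ => h₁.sub h₂) hδ (hζ Ω hΩ)
      hζ1 hε hg₁ hg₂ hf₁ hf₂ hu₁ hu₂ hb ht
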